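/- Let $s\ge 1$, $n\ge 2$, $l:=\lceil\log_2 s\rceil<n$, $\tilde s:=2^{l}$, and let $m$ be the greatest power of two with $m\le n-l$. Let $C_0,\dots,C_{s-1}\in\{0,1\}^n$ be pairwise distinct and let $a_0,\dots,a_{s-1}\in\{1,-1\}$ be arbitrary. The first $l$ qubits are the subspace register $s$ and the other $n-l$ qubits the register $r$. **Circuits.** They consist of Clifford gates, Toffoli gates (possibly with a negative control; cost one each), AND gates that compute the AND of two literals into a fresh ancilla (one Toffoli each), and adjoint AND gates, which uncompute such an ancilla with a Hadamard gate, a measurement, and a $CZ$ and a reset controlled on the outcome (no Toffolis). A *restricted partial unary iteration* (PUI) over an interval of values of the subspace register, with one operation $U_i$ for each value $i$ of the interval, is the circuit obtained by traversing the balanced binary tree of address values with AND and adjoint AND gates, entering only those half-intervals that meet the interval; it applies $U_i$ if the register holds a value $i$ of the interval and acts trivially for all other values. **Algorithm.** Keep the tableau of the strings $C_i$, extended by a flag bit $D_i$ (column $n$) that is initially $1$, a circuit $G$ (initially empty), a counter $k$ (initially $0$), a batch (initially empty) of current size $b$, and the signs $a_i$ still to be applied. Every operation appended to $G$ is also applied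 to the tableau and the signs. Repeat: * If $b=m$ or $k=s$: append the restricted PUI over $[k-b,k-1]$ that maps $|k_j\rangle^s|e_{q_j}\rangle^r|D_j\rangle\mapsto a_j|k_j\rangle^s|0\rangle^r|0\rangle$ for all $j$ in the batch (for each address in the interval it flips qubit $e_{q_j}$, flips the flag if $D_j=1$, and applies the sign $a_j$), and empty the batch. If $k=s$, stop. * Otherwise: 1. If some row $j$ is $1$ at a system qubit $p\ge l+b$, swap the qubits $p$ and $l+b$ (unless they are equal). 2. Otherwise, if some row $j$ not in the batch is non-zero in register $r$, choose $u$ with $l\le u<l+b$ at which it is $1$, and a column $v$ of the extended tableau at which it differs from the batch element $w$ that has its single $1$ of register $r$ at $u$. Append a Toffoli gate with target $l+b$, positive control $u$, and control $v$, which is positive or negative according to the value of row $j$ at $v$. 3. Otherwise, choose $j$ not in the batch with $D_j=1$. For every batch element with flag $1$, append a CX gate from its $1$ in register $r$ to $l+b$. Then append a CX gate from the flag to $l+b$. In each case, then append the multi-target CX gate controlled on $l+b$ that maps the system bits of row $j$ to $|k\rangle^s|e_b\rangle^r$, add $j$ to the batch and increase $k$ by one. **Claim.** The circuit uses $n+\max(l,1)+1$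 qubits in total, that is, $n+\lceil\log_2 s\rceil+1$ if $s\ge 2$: the $n$ system qubits, one flag qubit, one ancilla in state $|1\rangle$ on which the signs are applied by (controlled) $Z$ gates, and $\max(l-1,0)$ ancillas in state $|0\rangle$ for the AND gates. Whatever choices are made, the algorithm never gets stuck and stops after at most $s+\lceil s/m\rceil$ steps, where a step is either one extension of the batch or one PUI. When it has stopped: * exactly $\lceil s/m\rceil$ PUIs have been applied, and every $i\in\{0,\dots,s-1\}$ has been in exactly one of the batches iterated over; * there is a bijection $f$ of $\{0,\dots,s-1\}$, read off from the final tableau, such that $$G\,|C_i\rangle|1\rangle=a_i\,|f(i)\rangle^s|0\rangle^r|0\rangle\qquad\text{for all } i,$$ where the last qubit is the flag and the other ancillas are returned to their initial states. This holds coherently: for all $c_i\in\mathbb C$ and every list of outcomes of the $M$ measurements, the unnormalised output of $G$ on $\sum_i c_i|C_i\rangle|1\rangle$ is $2^{-M/2}\sum_i c_i a_i|f(i)\rangle^s|0\rangle^r|0\rangle$. The inverse circuit $G^{-1}$ (reverse order, AND and adjoint AND gates exchanged), which is the isometry circuit, maps $\sum_i c_i|f(i)\rangle^s|0\rangle^r|0\rangle$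 to $\sum_i c_i a_i|C_i\rangle|1\rangle$ in the same sense; for a real state $\sum_i x_i|C_i\rangle$ one can thus take $c_i=|x_i|$ and $a_i=\operatorname{sgn}(x_i)$. * $G$ and $G^{-1}$ each contain at most $$\Big\lceil\frac sm\Big\rceil\Big(2m+\log_2\frac{\tilde s}{m}-3\Big)$$ Toffoli gates. -/

import Mathlib

/-! ### Circuits with measurement-based uncomputation -/

/-- `flipBit t x` is the bitstring `x` with bit `t` negated. -/
def flipBit {W : Type} [DecidableEq W] (t : W) (x : W → Bool) : W → Bool :=
  Function.update x t (!x t)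

/-- Reversible gates that permute the computational basis.  `ccx u v b t` is the Toffoli gate with
target `t`, positive control `u`, and control `v` that is positive if `b = true` and negative
if `b = false`. -/
inductive RevGate (W : Type) where
  | x (t : W)
  | cx (c t : W)
  | swap (p q : W)
  | ccx (u v : W) (b : Bool) (t : W)

namespace RevGate

variable {V W : Type}

/-- Action on computational basis states (an involution for every valid gate). -/
def apply [DecidableEq W] : RevGate W → (W → Bool) → (W → Bool)
  | x t, z => flipBit t z
  | cx c t, z => if z c = true then flipBit t z else z
  | swap p q, z => z ∘ Equiv.swap p q
  | ccx u v b t, z => if z u = true ∧ z v = b then flipBit t z else z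

/-- Relabelling of the qubits. -/
def map (e : V → W) : RevGate V → RevGate W
  | x t => x (e t)
  | cx c t => cx (e c) (e t)
  | swap p q => swap (e p) (e q)
  | ccx u v b t => ccx (e u) (e v) b (e t)

/-- The qubits that a gate acts on are pairwise distinct. -/
def Valid : RevGate W → Prop
  | x _ => True
  | cx c t => c ≠ t
  | swap p q => p ≠ q
  | ccx u v _ t => u ≠ v ∧ u ≠ t ∧ v ≠ t

end RevGate

/-- Quantum gates: the reversible gates, the Pauli gate `Z`, the Hadamard gate, and the controlled
`Z` gate `cz u v b`, which multiplies by `-1` the basis states whose bit `u` is `1` and whose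
bit `v` is `b`.  All of them but the Toffoli gate are Clifford gates. -/
inductive QGate (W : Type) where
  | rev (g : RevGate W)
  | z (t : W)
  | h (t : W)
  | cz (u v : W) (b : Bool)

/-- State vectors on the qubits `W`, as functions of the computational basis states. -/
abbrev QState (W : Type) := (W → Bool) → ℂ

/-- The computational basis state `|z⟩`. -/
def ket {W : Type} [DecidableEq (W → Bool)] (z : W → Bool) : QState W := Pi.single z 1

namespace QGate

variable {W : Type}

/-- The unitary operator of a (valid) gate. -/
noncomputable def act [DecidableEq W] : QGate W → QState W → QState W
  | rev g, ψ => fun y => ψ (g.apply y)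
  | z t, ψ => fun y => if y t = true then -ψ y else ψ y
  | h t, ψ => fun y =>
      ((Real.sqrt 2 : ℝ) : ℂ)⁻¹ * (ψ (Function.update y t false) +
        (if y t = true then -1 else 1) * ψ (Function.update y t true))
  | cz u v b, ψ => fun y => if y u = true ∧ y v = b then -ψ y else ψ y

/-- The qubits that a gate acts on are pairwise distinct. -/
def Valid : QGate W → Prop
  | rev g => g.Valid
  | z _ => True
  | h _ => True
  | cz u v _ => u ≠ v

/-- The number of Toffoli gates. -/
def toffoli : QGate W → ℕ
  | rev (.ccx _ _ _ _) => 1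
  | _ => 0

end QGate

/-- The (unnormalised) projection onto the outcome `o` of a measurement of qubit `t` in the
computational basis. -/
def project {W : Type} (t : W) (o : Bool) (ψ : QState W) : QState W :=
  fun y => if y t = o then ψ y else 0

/-- The instructions of a circuit.  `andGate u v b t` computes the logical AND of the literals
`u` and `v` (the latter negated if `b = false`) into a fresh ancilla `t` by a Toffoli gate.
`andAdj u v b t` is its measurement-based inverse: it applies a Hadamard gate to `t` and measures
`t`; if the outcome is `1`, it applies the controlled `Z` gate to `u`, `v` and resets `t` to `0`. -/
inductive Instr (W : Type) where
  | gate (g : QGate W)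
  | andGate (u v : W) (b : Bool) (t : W)
  | andAdj (u v : W) (b : Bool) (t : W)

/-- A circuit, executed from left to right. -/
abbrev Circuit (W : Type) := List (Instr W)

namespace Instr

variable {W : Type}

def Valid : Instr W → Prop
  | gate g => g.Valid
  | andGate u v _ t => u ≠ v ∧ u ≠ t ∧ v ≠ t
  | andAdj u v _ t => u ≠ v ∧ u ≠ t ∧ v ≠ t

/-- Toffoli cost; the measurement-based `andAdj` uses Clifford gates and a measurement only. -/
def toffoli : Instr W → ℕ
  | gate g => g.toffoli
  | andGate _ _ _ _ => 1
  | andAdj _ _ _ _ => 0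

/-- The number of measurements. -/
def measurements : Instr W → ℕ
  | andAdj _ _ _ _ => 1
  | _ => 0

/-- The inverse instruction; every gate above is its own inverse. -/
def inverse : Instr W → Instr W
  | gate g => gate g
  | andGate u v b t => andAdj u v b t
  | andAdj u v b t => andGate u v b t

/-- The operator of `andAdj u v b t` conditioned on the measurement outcome `o`. -/
noncomputable def uncompute [DecidableEq W] (u v : W) (b : Bool) (t : W) (o : Bool)
    (ψ : QState W) : QState W :=
  let φ := project t o ((QGate.h t).act ψ)
  if o = true then (QGate.rev (.x t)).act ((QGate.cz u v b).act φ) else φ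

end Instr

namespace Circuit

variable {W : Type}

def Valid (G : Circuit W) : Prop := ∀ g ∈ G, Instr.Valid g

/-- The Toffoli count of a circuit. -/
def toffoli (G : Circuit W) : ℕ := (List.map Instr.toffoli G).sum

/-- The number of measurements in a circuit. -/
def measurements (G : Circuit W) : ℕ := (List.map Instr.measurements G).sum

/-- The inverse circuit. -/
def inverse (G : Circuit W) : Circuit W := (List.map Instr.inverse G).reverse

/-- The unnormalised final state of a circuit, given the list of its measurement outcomes. -/
noncomputable def run [DecidableEq W] : Circuit W → List Bool → QState W → QState W
  | [], _, ψ => ψ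
  | .gate g :: G, o, ψ => run G o (g.act ψ)
  | .andGate u v b t :: G, o, ψ => run G o ((QGate.rev (.ccx u v b t)).act ψ)
  | .andAdj _ _ _ _ :: _, [], _ => 0
  | .andAdj u v b t :: G, r :: o, ψ => run G o (Instr.uncompute u v b t r ψ)

/-- The circuit maps `∑ i, c i |x i⟩` to `∑ i, c i (σ i) |y i⟩` for all coefficients `c`, whatever
the measurement outcomes are.  Each of the `2 ^ measurements` lists of outcomes has
amplitude `(1 / √2) ^ measurements`. -/
def Implements [Fintype W] [DecidableEq W] (G : Circuit W) {ι : Type} [Fintype ι] (σ : ι → ℤˣ)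
    (x y : ι → W → Bool) : Prop :=
  ∀ (c : ι → ℂ) (o : List Bool), o.length = G.measurements →
    G.run o (∑ i, c i • ket (x i)) =
      ((((Real.sqrt 2 : ℝ) : ℂ)⁻¹) ^ G.measurements) •
        ∑ i, (c i * (((σ i : ℤˣ) : ℤ) : ℂ)) • ket (y i)

end Circuit

/-! ### Restricted partial unary iteration -/

section PartialUnaryIteration

variable {W : Type}

/-- The intervals `[lo, hi)` and `[base, base + len)` intersect. -/
abbrev Meets (lo hi base len : ℕ) : Prop := max lo base < min hi (base + len)

/-- The recursion below the root of the binary tree.  `c` is the qubit that selects the current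
interval, which starts at `base`; the list holds the remaining address qubits (most significant
first), each with the ancilla for the AND gate of its tree level.  Only the half-intervals that
meet `[lo, hi)` are entered. -/
def unaryBranch (lo hi : ℕ) (leaf : ℕ → Option W → Circuit W) :
    W → List (W × W) → ℕ → Circuit W
  | c, [], base => leaf base (some c)
  | c, (d, t) :: rest, base =>
      let len := 2 ^ rest.length
      if Meets lo hi base len then
        if Meets lo hi (base + len) len then
          [.andGate c d false t] ++ unaryBranch lo hi leaf t rest base ++
            [.gate (.rev (.cx c t))] ++ unaryBranch lo hi leaf t rest (base + len) ++
            [.andAdj c d true t]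
        else
          [.andGate c d false t] ++ unaryBranch lo hi leaf t rest base ++ [.andAdj c d false t]
      else if Meets lo hi (base + len) len then
        [.andGate c d true t] ++ unaryBranch lo hi leaf t rest (base + len) ++
          [.andAdj c d true t]
      else []

/-- The restricted partial unary iteration over the values in `[lo, hi)` of the address register
`addr` (most significant qubit first): `leaf i c` is applied, controlled on `c`, for each
`i ∈ [lo, hi)`.  At the root no control is present, and the first address qubit itself is used to
select the two half-intervals. -/
def restrictedPUI (lo hi : ℕ) (leaf : ℕ → Option W → Circuit W) (addr anc : List W) : Circuit W :=
  match addr with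
  | [] => leaf 0 none
  | d :: rest =>
      let len := 2 ^ rest.length
      let left := unaryBranch lo hi leaf d (rest.zip anc) 0
      let right := unaryBranch lo hi leaf d (rest.zip anc) len
      (if Meets lo hi 0 len then
        [.gate (.rev (.x d))] ++ left ++ [.gate (.rev (.x d))] else []) ++
      (if Meets lo hi len len then right else [])

/-- `X` on `t`, controlled on `c` if a control is given. -/
def ctrlX (c : Option W) (t : W) : Instr W :=
  match c with
  | none => .gate (.rev (.x t))
  | some c => .gate (.rev (.cx c t))

/-- `Z` on `t`, controlled on `c` if a control is given. -/
def ctrlZ (c : Option W) (t : W) : Instr W :=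
  match c with
  | none => .gate (.z t)
  | some c => .gate (.cz c t true)

end PartialUnaryIteration

/-! ### The algorithm -/

/-- The number `⌈log₂ s⌉` of qubits in the subspace register. -/
abbrev subspaceQubits (s : ℕ) : ℕ := Nat.clog 2 s

/-- The greatest power of two that is at most `n - ⌈log₂ s⌉`. -/
abbrev batchSize (n s : ℕ) : ℕ := 2 ^ Nat.log 2 (n - subspaceQubits s)

/-- The qubits of the circuit: the `n + 1` tableau columns (the `n` system qubits, of which the
first `⌈log₂ s⌉` are the subspace register, and the flag qubit with index `n`), an ancilla in
state `|1⟩` on which signs are applied, and the ancillas for the AND gates. -/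
inductive Wire (n s : ℕ) where
  | col (i : Fin (n + 1))
  | phase
  | anc (i : Fin (subspaceQubits s - 1))
deriving DecidableEq, Fintype

/-- A row of the extended tableau: an `n`-bit string followed by the flag bit. -/
abbrev Row (n : ℕ) := Fin (n + 1) → Bool

/-- The tableau column with index `i ≤ n`. -/
abbrev colIdx (n i : ℕ) : Fin (n + 1) := Fin.ofNat (n + 1) i

/-- The content of the subspace register of a row, in big-endian order. -/
def address (s : ℕ) {n : ℕ} (x : Row n) : ℕ :=
  ∑ i : Fin (n + 1),
    if (i : ℕ) < subspaceQubits s ∧ x i = true then 2 ^ (subspaceQubits s - 1 - (i : ℕ)) else 0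

/-- The row `|k⟩|0⟩|0⟩`: `k` in the subspace register, and `0` everywhere else. -/
def subspaceRow (n s k : ℕ) : Row n := fun i =>
  decide ((i : ℕ) < subspaceQubits s) && k.testBit (subspaceQubits s - 1 - (i : ℕ))

/-- The basis state of all qubits that belongs to a row: the phase ancilla is `1`, the other
ancillas are `0`. -/
def Row.toWires {n : ℕ} (s : ℕ) (x : Row n) : Wire n s → Bool
  | .col i => x i
  | .phase => true
  | .anc _ => false

/-- The state of the algorithm: the circuit built so far, the runner variable `k`, the row indices
of the current batch, the batches that have been iterated over, the tableau, and the signs that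
are still to be applied to its rows. -/
structure Config (n s : ℕ) where
  circuit : Circuit (Wire n s)
  k : ℕ
  batch : List (Fin s)
  batches : List (List (Fin s))
  row : Fin s → Row n
  sign : Fin s → ℤˣ

namespace Config

variable {n s : ℕ}

/-- The initial state: the tableau is extended by a column of ones. -/
def init (C : Fin s → Fin n → Bool) (a : Fin s → ℤˣ) : Config n s where
  circuit := []
  k := 0
  batch := []
  batches := []
  row := fun i => Fin.snoc (α := fun _ => Bool) (C i) true
  sign := a

/-- Append gates to the circuit and update the tableau. -/
def append (c : Config n s) (gs : List (RevGate (Fin (n + 1)))) : Config n s :=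
  { c with
    circuit := c.circuit ++ gs.map fun g => .gate (.rev (g.map Wire.col))
    row := fun i => gs.foldl (fun x g => g.apply x) (c.row i) }

/-- The first address of the current batch. -/
abbrev lo (c : Config n s) : ℕ := c.k - c.batch.length

/-- The batch element that belongs to an address. -/
def slot (c : Config n s) (A : ℕ) : Option (Fin s) :=
  if c.lo ≤ A then c.batch[A - c.lo]? else none

/-- The column that is set in the batch element with address `A`. -/
abbrev slotCol (c : Config n s) (A : ℕ) : Fin (n + 1) :=
  colIdx n (subspaceQubits s + (A - c.lo))

/-- The operation applied by the partial unary iteration for the address `A` of the batch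
element `j`: it maps `|e_q⟩|D_j⟩` to `a_j|0⟩|0⟩` outside the subspace register. -/
def leaf (c : Config n s) (A : ℕ) (ctrl : Option (Wire n s)) : Circuit (Wire n s) :=
  match c.slot A with
  | none => []
  | some j =>
      [ctrlX ctrl (.col (c.slotCol A))] ++
      (if c.row j (Fin.last n) = true then [ctrlX ctrl (.col (Fin.last n))] else []) ++
      (if c.sign j = -1 then [ctrlZ ctrl .phase] else [])

/-- The circuit of the restricted partial unary iteration over the current batch. -/
def pui (c : Config n s) : Circuit (Wire n s) :=
  restrictedPUI c.lo c.k c.leaf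
    ((List.range (subspaceQubits s)).map fun i => .col (colIdx n i))
    ((List.finRange (subspaceQubits s - 1)).map .anc)

/-- Apply the restricted partial unary iteration to the circuit, the tableau and the signs, and
empty the batch. -/
def flush (c : Config n s) : Config n s where
  circuit := c.circuit ++ c.pui
  k := c.k
  batch := []
  batches := c.batches ++ [c.batch]
  row := fun i =>
    match c.slot (address s (c.row i)) with
    | none => c.row i
    | some j =>
        let x := flipBit (c.slotCol (address s (c.row i))) (c.row i)
        if c.row j (Fin.last n) = true then flipBit (Fin.last n) x else x
  sign := fun i =>
    match c.slot (address s (c.row i)) with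
    | none => c.sign i
    | some j => c.sign i * c.sign j

/-- The column that the next batch element has to be `1` at. -/
abbrev pivot (c : Config n s) : Fin (n + 1) := colIdx n (subspaceQubits s + c.batch.length)

/-- Map row `j` to `|k⟩|e_b⟩` by a multi-target CX gate controlled on the pivot column (the
product of CX gates with this control), and add `j` to the batch. -/
def push (c : Config n s) (j : Fin s) : Config n s :=
  let targets := (List.finRange (n + 1)).filter fun i =>
    decide (i ≠ Fin.last n ∧ i ≠ c.pivot ∧ c.row j i ≠ subspaceRow n s c.k i)
  let c' := c.append (targets.map fun i => .cx c.pivot i)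
  { c' with k := c.k + 1, batch := c.batch ++ [j] }

/-- Row `j` is non-zero at a system qubit `r` not used by the batch: `r ≥ ⌈log₂ s⌉ + b`. -/
def HasFree (c : Config n s) (j : Fin s) (r : Fin (n + 1)) : Prop :=
  subspaceQubits s + c.batch.length ≤ (r : ℕ) ∧ (r : ℕ) < n ∧ c.row j r = true

/-- Row `j` is not in the batch and non-zero at the system qubit `u` of the non-subspace
register. -/
def Outside (c : Config n s) (j : Fin s) (u : Fin (n + 1)) : Prop :=
  j ∉ c.batch ∧ subspaceQubits s ≤ (u : ℕ) ∧ (u : ℕ) < n ∧ c.row j u = true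

/-- The gates that counter the effect of the CX gate controlled on the flag on the batch. -/
def counter (c : Config n s) : List (RevGate (Fin (n + 1))) :=
  (List.range c.batch.length).filterMap fun t =>
    match c.batch[t]? with
    | some i => if c.row i (Fin.last n) = true
        then some (.cx (colIdx n (subspaceQubits s + t)) c.pivot) else none
    | none => none

/-- `Prepare c gs j`: the gates `gs` may be chosen to create a `1` in the pivot column of row `j`,
which is to become the next batch element. -/
inductive Prepare (c : Config n s) : List (RevGate (Fin (n + 1))) → Fin s → Prop
  | swap (j : Fin s) (r : Fin (n + 1)) (hr : c.HasFree j r) :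
      Prepare c (if r = c.pivot then [] else [.swap r c.pivot]) j
  | toffoli (hfree : ∀ i r, ¬ c.HasFree i r) (j : Fin s) (u v : Fin (n + 1)) (w : Fin s)
      (hu : c.Outside j u) (hw : c.batch[(u : ℕ) - subspaceQubits s]? = some w)
      (hv : c.row j v ≠ c.row w v) :
      Prepare c [.ccx u v (c.row j v) c.pivot] j
  | flag (hfree : ∀ i r, ¬ c.HasFree i r) (hout : ∀ i u, ¬ c.Outside i u) (j : Fin s)
      (hj : j ∉ c.batch) (hD : c.row j (Fin.last n) = true) :
      Prepare c (c.counter ++ [.cx (Fin.last n) c.pivot]) j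

/-- One step of the algorithm: if the batch is full or all rows have been put into a batch, iterate
over the batch; otherwise extend the batch.  All choices are arbitrary. -/
inductive Step : Config n s → Config n s → Prop
  | flush (c : Config n s) (hb : c.batch ≠ [])
      (h : c.batch.length = batchSize n s ∨ c.k = s) : Step c c.flush
  | push (c : Config n s) (hb : c.batch.length ≠ batchSize n s) (hk : c.k ≠ s)
      (gs : List (RevGate (Fin (n + 1)))) (j : Fin s) (h : c.Prepare gs j) :
      Step c ((c.append gs).push j)

/-- `Run C a N c`: the algorithm with input `C`, `a` can be in state `c` after `N` steps. -/
inductive Run (C : Fin s → Fin n → Bool) (a : Fin s → ℤˣ) : ℕ → Config n s → Prop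
  | init : Run C a 0 (init C a)
  | step {N : ℕ} {c c' : Config n s} : Run C a N c → Step c c' → Run C a (N + 1) c'

/-- The algorithm returns: all rows have been iterated over. -/
def Finished (c : Config n s) : Prop := c.k = s ∧ c.batch = []

end Config

/-- The bound `⌈s/m⌉ (2 m + log₂ (s̃/m) - 3)` with `s̃ = 2 ^ ⌈log₂ s⌉`. -/
noncomputable def toffoliBound (n s : ℕ) : ℝ :=
  (⌈(s : ℝ) / (batchSize n s : ℝ)⌉₊ : ℝ) *
    (2 * (batchSize n s : ℝ) +
      Real.logb 2 ((2 : ℝ) ^ subspaceQubits s / (batchSize n s : ℝ)) - 3)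

/-! The proof follows single basis states. `Circuit.Realizes G x ε y` says that, for every list of
measurement outcomes, `G` takes `|x⟩` to `ε |y⟩` up to a factor `1/√2` per measurement, and that
`G.inverse` takes `|y⟩` back to `ε |x⟩`. Such statements compose. Since the factor does not depend
on `x`, linearity lifts them to superpositions (`implements_of_mapsKet`). Measurements do no harm
because the controlled `Z` gate cancels the sign that outcome `1` produces (`uncompute_ket`).

A partial unary iteration flips bits and applies a sign, both depending only on the address
(`restrictedPUI_realizes`), so it acts on rows and signs as `Config.flush` prescribes. Write `m =
2^μ`. Every batch starts at a multiple of `m`; so, for `m < s̃`, the tree is entered along a single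
path down to a subtree with `m` leaves, which costs at most `(l - 1 - μ) + (m - 1)` AND gates
(`restrictedPUI_toffoli_le`).

The algorithm is controlled by the invariant `Config.Inv`. Rows already iterated over are
`|A⟩|0⟩|0⟩`, the batch element in slot `t` is `|lo + t⟩|e_t⟩` up to its flag, and every row not yet
in a batch is live: its flag or some bit of register `r` is `1`. Extensions preserve this because
their gates fix all rows already in batches (`Prepared`, `Inv.push`). A partial unary iteration
preserves liveness because a row that it sent to `|A⟩|0⟩|0⟩` would have been equal to the batch
element of address `A` (`flush_live`), while rows stay distinct by reversibility. Liveness and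
distinctness also imply that one of the three extensions is always available (`exists_step`).

The first element of a batch needs no Toffoli gate and each later one at most one, so a batch costs
at most `(m - 1) + (m + l - μ - 2)`. Only the last batch can be shorter than `m`, which gives
`⌈s/m⌉` batches. -/

/-! ### Circuits on computational basis states -/

namespace RevGate

variable {V W : Type}

theorem Valid.map {e : V → W} (he : Function.Injective e) {g : RevGate V} (hg : g.Valid) :
    (g.map e).Valid := by
  cases g <;> simp_all [RevGate.map, Valid, he.ne_iff]

variable [DecidableEq V] [DecidableEq W]

theorem flipBit_flipBit (t : W) (x : W → Bool) : flipBit t (flipBit t x) = x := by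
  simp [flipBit]

theorem flipBit_self (t : W) (x : W → Bool) : flipBit t x t = !x t := by simp [flipBit]

theorem flipBit_ne {t w : W} (h : w ≠ t) (x : W → Bool) : flipBit t x w = x w := by
  simp [flipBit, h]

theorem apply_apply {g : RevGate W} (hg : g.Valid) (z : W → Bool) : g.apply (g.apply z) = z := by
  cases g with
  | x t => simp [apply, flipBit_flipBit]
  | cx c t =>
    have h : c ≠ t := hg
    by_cases hc : z c = true <;> simp [apply, hc, flipBit_flipBit, flipBit_ne h]
  | swap p q =>
    funext w
    simp [apply]
  | ccx u v b t =>
    obtain ⟨-, h1, h2⟩ := hg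
    by_cases hc : z u = true ∧ z v = b
    · simp [apply, hc, flipBit_flipBit, flipBit_ne h1, flipBit_ne h2]
    · simp [apply, hc]

end RevGate

/-! ### Quantum gates and measurement-based uncomputation on basis states -/

namespace QGate

variable {W : Type}

theorem ket_apply [DecidableEq (W → Bool)] (x y : W → Bool) : ket x y = if y = x then 1 else 0 := by
  simp [ket, Pi.single_apply]

variable [DecidableEq W]

theorem act_isLinearMap (g : QGate W) : IsLinearMap ℂ g.act := by
  cases g <;> refine ⟨fun φ ψ => ?_, fun a φ => ?_⟩ <;> funext y <;>
    simp only [act, Pi.add_apply, Pi.smul_apply, smul_eq_mul] <;>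
    (try split_ifs) <;> ring

variable [Fintype W]

theorem act_rev_ket {g : RevGate W} (hg : g.Valid) (x : W → Bool) :
    (rev g).act (ket x) = ket (g.apply x) := by
  funext y
  simp only [act, ket_apply]
  refine if_congr ⟨fun h => ?_, fun h => ?_⟩ rfl rfl
  · rw [← h, RevGate.apply_apply hg]
  · rw [h, RevGate.apply_apply hg]

theorem act_z_ket (t : W) (x : W → Bool) :
    (z t).act (ket x) = (if x t = true then -1 else 1 : ℂ) • ket x := by
  funext y
  simp only [act, ket_apply, Pi.smul_apply, smul_eq_mul]
  by_cases h : y = x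
  · subst h; split_ifs <;> simp
  · simp [h]

theorem act_cz_ket (u v : W) (b : Bool) (x : W → Bool) :
    (cz u v b).act (ket x) = (if x u = true ∧ x v = b then -1 else 1 : ℂ) • ket x := by
  funext y
  simp only [act, ket_apply, Pi.smul_apply, smul_eq_mul]
  by_cases h : y = x
  · subst h; split_ifs <;> simp
  · simp [h]

end QGate

theorem project_isLinearMap {W : Type} (t : W) (o : Bool) : IsLinearMap ℂ (project t o) := by
  refine ⟨fun φ ψ => ?_, fun a φ => ?_⟩ <;> funext y <;>
    simp only [project, Pi.add_apply, Pi.smul_apply, smul_eq_mul] <;> split_ifs <;> simp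

namespace Instr

variable {W : Type} [DecidableEq W]

theorem uncompute_isLinearMap (u v : W) (b : Bool) (t : W) (o : Bool) :
    IsLinearMap ℂ (uncompute u v b t o) := by
  have h := QGate.act_isLinearMap (QGate.h t)
  have p := project_isLinearMap t o
  have z := QGate.act_isLinearMap (QGate.cz u v b)
  have r := QGate.act_isLinearMap (QGate.rev (.x t))
  cases o <;> refine ⟨fun φ ψ => ?_, fun a φ => ?_⟩ <;>
    simp [uncompute, h.map_add, p.map_add, z.map_add, r.map_add, h.map_smul, p.map_smul,
      z.map_smul, r.map_smul]

variable [Fintype W]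

theorem h_ket (t : W) (x : W → Bool) :
    (QGate.h t).act (ket x) = ((Real.sqrt 2 : ℝ) : ℂ)⁻¹ • (ket (Function.update x t false) +
      (if x t = true then -1 else 1 : ℂ) • ket (Function.update x t true)) := by
  funext y
  simp only [QGate.act, QGate.ket_apply, Pi.smul_apply, Pi.add_apply, smul_eq_mul]
  congr 1
  -- Both sides vanish unless `y` agrees with `x` off `t`. The two equivalences isolate this
  -- condition, leaving a check of the four values of `x t` and `y t`.
  have key : ∀ b : Bool, Function.update y t b = x ↔
      x t = b ∧ y = Function.update x t (y t) := by
    intro b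
    constructor
    · rintro rfl; simp
    · rintro ⟨rfl, h⟩
      rw [h]; simp
  have key2 : ∀ b : Bool, y = Function.update x t b ↔
      y t = b ∧ y = Function.update x t (y t) := by
    intro b
    constructor
    · intro h
      have h1 : y t = b := by rw [h]; simp
      exact ⟨h1, by rw [h1]; exact h⟩
    · rintro ⟨rfl, h⟩; exact h
  rw [if_congr (key true) rfl rfl, if_congr (key false) rfl rfl, if_congr (key2 true) rfl rfl,
    if_congr (key2 false) rfl rfl]
  by_cases h : y = Function.update x t (y t)
  · simp only [eq_true h, and_true]
    cases x t <;> cases y t <;> simp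
  · simp only [eq_false h, and_false, if_false, mul_zero, add_zero]

/-- After the Hadamard gate both outcomes have amplitude `1/√2`, and outcome `1` carries the sign
`(-1)^(x t)`. As `t` holds the AND of the two literals, the controlled `Z` gate contributes the same
sign and cancels it; after the reset the outcome leaves no trace. -/
theorem uncompute_ket {u v t : W} {b : Bool} (hu : u ≠ t) (hv : v ≠ t) (o : Bool) {x : W → Bool}
    (hx : x t = (x u && (x v == b))) :
    uncompute u v b t o (ket x) =
      ((Real.sqrt 2 : ℝ) : ℂ)⁻¹ • ket (Function.update x t false) := by
  have hp : ∀ o o' : Bool, project t o (ket (Function.update x t o')) =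
      if o' = o then ket (Function.update x t o') else 0 := by
    intro o o'
    funext y
    by_cases h : y = Function.update x t o'
    · subst h
      by_cases h' : o' = o <;> simp [project, h']
    · have hk : ket (Function.update x t o') y = 0 := by rw [QGate.ket_apply, if_neg h]
      simp only [project, hk, ite_self]
      split_ifs
      · exact hk.symm
      · rfl
  have hl := project_isLinearMap t o (W := W)
  cases o
  · simp only [uncompute, h_ket, hl.map_smul, hl.map_add, hp]
    simp
  · have hz := QGate.act_isLinearMap (QGate.cz u v b)
    have hr := QGate.act_isLinearMap (QGate.rev (.x t))
    simp only [uncompute, h_ket, hl.map_smul, hl.map_add, hp, hz.map_smul, hr.map_smul,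
      QGate.act_cz_ket, if_true, if_false, reduceCtorEq, zero_add]
    rw [QGate.act_rev_ket (by trivial)]
    have e1 : (RevGate.x t).apply (Function.update x t true) = Function.update x t false := by
      simp [RevGate.apply, flipBit]
    rw [e1, Function.update_of_ne hu, Function.update_of_ne hv, hx]
    cases x u <;> cases h : (x v == b) <;> simp_all

end Instr

/-! ### Composition and linearity of circuits -/

namespace Circuit

variable {W : Type}

theorem measurements_append (G H : Circuit W) :
    measurements (G ++ H) = G.measurements + H.measurements := by
  simp [measurements]

theorem toffoli_append (G H : Circuit W) : toffoli (G ++ H) = G.toffoli + H.toffoli := by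
  simp [toffoli]

theorem toffoli_nil : toffoli ([] : Circuit W) = 0 := rfl

theorem inverse_nil : inverse ([] : Circuit W) = [] := rfl

theorem inverse_append (G H : Circuit W) : inverse (G ++ H) = H.inverse ++ G.inverse := by
  simp [inverse]

theorem inverse_inverse (G : Circuit W) : G.inverse.inverse = G := by
  have h : Instr.inverse ∘ Instr.inverse = (id : Instr W → Instr W) := by
    funext i; cases i <;> rfl
  simp [inverse, h]

theorem valid_append {G H : Circuit W} : Valid (G ++ H) ↔ G.Valid ∧ H.Valid := by
  simp only [Valid, List.mem_append, or_imp, forall_and]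

theorem valid_nil : Valid ([] : Circuit W) := by simp [Valid]

theorem valid_singleton {i : Instr W} : Valid [i] ↔ i.Valid := by simp [Valid]

variable [DecidableEq W]

theorem run_isLinearMap (G : Circuit W) (o : List Bool) : IsLinearMap ℂ (G.run o) := by
  induction G generalizing o with
  | nil => exact ⟨fun _ _ => rfl, fun _ _ => rfl⟩
  | cons i G ih =>
    cases i with
    | gate g =>
      have h := QGate.act_isLinearMap g
      exact ⟨fun φ ψ => by simp [run, h.map_add, (ih o).map_add],
        fun a φ => by simp [run, h.map_smul, (ih o).map_smul]⟩
    | andGate u v b t =>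
      have h := QGate.act_isLinearMap (.rev (.ccx u v b t))
      exact ⟨fun φ ψ => by simp [run, h.map_add, (ih o).map_add],
        fun a φ => by simp [run, h.map_smul, (ih o).map_smul]⟩
    | andAdj u v b t =>
      cases o with
      | nil => exact ⟨fun φ ψ => by simp [run], fun a φ => by simp [run]⟩
      | cons r o =>
        have h := Instr.uncompute_isLinearMap u v b t r
        exact ⟨fun φ ψ => by simp [run, h.map_add, (ih o).map_add],
          fun a φ => by simp [run, h.map_smul, (ih o).map_smul]⟩

theorem run_append (G H : Circuit W) {o : List Bool} (ho : o.length = G.measurements)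
    (o' : List Bool) (ψ : QState W) : (G ++ H).run (o ++ o') ψ = H.run o' (G.run o ψ) := by
  induction G generalizing o ψ with
  | nil =>
    have : o = [] := List.length_eq_zero_iff.1 (by simpa [measurements] using ho)
    simp [this, run]
  | cons i G ih =>
    cases i with
    | gate g =>
      simp only [List.cons_append, run]
      exact ih (by simpa [measurements, Instr.measurements] using ho) _
    | andGate u v b t =>
      simp only [List.cons_append, run]
      exact ih (by simpa [measurements, Instr.measurements] using ho) _
    | andAdj u v b t =>
      cases o with
      | nil =>
        simp only [measurements, Instr.measurements, List.map_cons, List.sum_cons,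
          List.length_nil] at ho
        omega
      | cons r o =>
        simp only [List.cons_append, run]
        refine ih ?_ _
        simp only [measurements, Instr.measurements, List.length_cons, List.map_cons,
          List.sum_cons] at ho ⊢
        omega

variable [Fintype W]

/-- The circuit maps `|x⟩` to `ε |y⟩`, up to the amplitude of the measurement outcomes. -/
def MapsKet (G : Circuit W) (x : W → Bool) (ε : ℤˣ) (y : W → Bool) : Prop :=
  ∀ o : List Bool, o.length = G.measurements → G.run o (ket x) =
    ((((Real.sqrt 2 : ℝ) : ℂ)⁻¹) ^ G.measurements) • ((ε : ℤ) : ℂ) • ket y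

theorem MapsKet.append {G H : Circuit W} {x y z : W → Bool} {ε δ : ℤˣ} (hG : G.MapsKet x ε y)
    (hH : H.MapsKet y δ z) : MapsKet (G ++ H) x (ε * δ) z := by
  intro o ho
  rw [measurements_append] at ho
  have h1 : (o.take G.measurements).length = G.measurements := by
    rw [List.length_take]; omega
  have h2 : (o.drop G.measurements).length = H.measurements := by
    rw [List.length_drop]; omega
  rw [← List.take_append_drop G.measurements o, run_append _ _ h1, hG _ h1,
    (run_isLinearMap _ _).map_smul, (run_isLinearMap _ _).map_smul, hH _ h2, measurements_append,
    pow_add]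
  simp only [smul_smul]
  congr 1
  push_cast
  ring

/-- The measurement factor is common to all basis states, so no relative amplitude or phase arises
and linearity suffices. -/
theorem implements_of_mapsKet {G : Circuit W} {ι : Type} [Fintype ι] {σ : ι → ℤˣ}
    {x y : ι → W → Bool} (h : ∀ i, G.MapsKet (x i) (σ i) (y i)) : G.Implements σ x y := by
  intro c o ho
  have hl := map_sum (IsLinearMap.mk' _ (run_isLinearMap G o)) (fun i => c i • ket (x i))
    Finset.univ
  simp only [IsLinearMap.mk'_apply] at hl
  rw [hl, Finset.smul_sum]
  refine Finset.sum_congr rfl fun i _ => ?_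
  rw [(run_isLinearMap G o).map_smul, h i o ho]
  simp only [smul_smul]
  congr 1
  ring

/-- The circuit maps `|x⟩` to `ε |y⟩` and its inverse maps `|y⟩` to `ε |x⟩`. -/
def Realizes (G : Circuit W) (x : W → Bool) (ε : ℤˣ) (y : W → Bool) : Prop :=
  G.MapsKet x ε y ∧ G.inverse.MapsKet y ε x

namespace Realizes

variable {G H : Circuit W} {x y : W → Bool} {ε δ : ℤˣ}

theorem nil (x : W → Bool) : Realizes [] x 1 x := by
  constructor <;> intro o _ <;> simp [run, inverse, measurements]

theorem append {z : W → Bool} (hG : G.Realizes x ε y) (hH : H.Realizes y δ z) :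
    Realizes (G ++ H) x (ε * δ) z := by
  refine ⟨hG.1.append hH.1, ?_⟩
  rw [inverse_append, mul_comm]
  exact hH.2.append hG.2

theorem symm (h : G.Realizes x ε y) : G.inverse.Realizes y ε x :=
  ⟨h.2, by rw [inverse_inverse]; exact h.1⟩

/-- Distinct basis states have distinct images. -/
theorem source_unique {x' : W → Bool} (h : G.Realizes x ε y) (h' : G.Realizes x' δ y) :
    x = x' := by
  -- Any list of outcomes will do: the inverse circuit sends `|y⟩` to non-zero multiples of both
  -- kets, and the coefficient at `x` tells them apart.
  have e := (h.2 (List.replicate _ false) List.length_replicate).symm.trans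
    (h'.2 (List.replicate _ false) List.length_replicate)
  have hs : ((((Real.sqrt 2 : ℝ) : ℂ)⁻¹) ^ G.inverse.measurements) ≠ 0 := by
    simp
  have e' := congrFun (smul_right_injective _ hs e) x
  by_contra hne
  simp [QGate.ket_apply, hne] at e'

theorem of_act {g : QGate W} (h : g.act (ket x) = ((ε : ℤ) : ℂ) • ket y)
    (h' : g.act (ket y) = ((ε : ℤ) : ℂ) • ket x) : Realizes [.gate g] x ε y := by
  constructor <;> intro o _ <;>
    simp [run, inverse, Instr.inverse, measurements, Instr.measurements, h, h']

theorem rev {g : RevGate W} (hg : g.Valid) (x : W → Bool) :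
    Realizes [.gate (.rev g)] x 1 (g.apply x) := by
  refine of_act ?_ ?_
  · simp [QGate.act_rev_ket hg]
  · simp [QGate.act_rev_ket hg, RevGate.apply_apply hg]

theorem z (t : W) (x : W → Bool) : Realizes [.gate (.z t)] x (if x t = true then -1 else 1) x := by
  refine of_act ?_ ?_ <;> rw [QGate.act_z_ket] <;> split_ifs <;> simp

theorem cz (u v : W) (b : Bool) (x : W → Bool) :
    Realizes [.gate (.cz u v b)] x (if x u = true ∧ x v = b then -1 else 1) x := by
  refine of_act ?_ ?_ <;> rw [QGate.act_cz_ket] <;> split_ifs <;> simp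

theorem andGate {u v t : W} {b : Bool} (hv : (Instr.andGate u v b t).Valid) {x : W → Bool}
    (hx : x t = false) :
    Realizes [.andGate u v b t] x 1 (Function.update x t (x u && (x v == b))) := by
  obtain ⟨h0, h1, h2⟩ := hv
  constructor
  · intro o _
    have hg : (RevGate.ccx u v b t).Valid := ⟨h0, h1, h2⟩
    have : (RevGate.ccx u v b t).apply x = Function.update x t (x u && (x v == b)) := by
      by_cases h : x u = true ∧ x v = b
      · simp [RevGate.apply, h, flipBit, hx]
      · have h' : (x u && (x v == b)) = false := by
          rw [Bool.eq_false_iff]; simpa using h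
        rw [h', RevGate.apply, if_neg h, ← hx, Function.update_eq_self]
    simp [run, measurements, Instr.measurements, QGate.act_rev_ket hg, this]
  · intro o ho
    match o, ho with
    | [r], _ =>
      simp only [run, inverse, Instr.inverse, measurements, Instr.measurements, List.map_cons,
        List.map_nil, List.reverse_singleton, List.sum_singleton, pow_one]
      rw [Instr.uncompute_ket h1 h2 _ (by simp [h1, h2])]
      simp [← hx]

theorem andAdj {u v t : W} {b : Bool} (hv : (Instr.andAdj u v b t).Valid) {x : W → Bool}
    (hx : x t = (x u && (x v == b))) :
    Realizes [.andAdj u v b t] x 1 (Function.update x t false) := by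
  obtain ⟨h0, h1, h2⟩ := hv
  -- The adjoint AND gate is the inverse of the AND gate that computes into the cleared ancilla.
  have h := (andGate (b := b) (x := Function.update x t false) ⟨h0, h1, h2⟩ (by simp)).symm
  simpa [inverse, Instr.inverse, h1, h2, ← hx] using h

end Realizes

end Circuit

/-! ### Semantics of the restricted partial unary iteration -/

section ReadAddress

variable {W : Type}

/-- The number held by an address register, most significant qubit first. -/
def readAddress (x : W → Bool) : List W → ℕ
  | [] => 0
  | d :: rest => (if x d = true then 2 ^ rest.length else 0) + readAddress x rest

theorem readAddress_congr {x y : W → Bool} {L : List W} (h : ∀ d ∈ L, x d = y d) :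
    readAddress x L = readAddress y L := by
  induction L with
  | nil => rfl
  | cons d rest ih =>
    simp only [readAddress]
    rw [h d (by simp), ih fun e he => h e (by simp [he])]

theorem readAddress_lt (x : W → Bool) (L : List W) : readAddress x L < 2 ^ L.length := by
  induction L with
  | nil => simp [readAddress]
  | cons d rest ih =>
    simp only [readAddress, List.length_cons, pow_succ]
    split_ifs <;> omega

theorem eq_of_readAddress_eq {x y : W → Bool} {L : List W}
    (h : readAddress x L = readAddress y L) : ∀ d ∈ L, x d = y d := by
  induction L with
  | nil => simp
  | cons d rest ih =>
    have hx := readAddress_lt x rest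
    have hy := readAddress_lt y rest
    simp only [readAddress] at h
    have hd : x d = y d ∧ readAddress x rest = readAddress y rest := by
      cases h1 : x d <;> cases h2 : y d <;> simp [h1, h2] at h ⊢ <;> omega
    intro e he
    rcases List.mem_cons.1 he with rfl | he
    · exact hd.1
    · exact ih hd.2 e he

theorem readAddress_map_range (x : W → Bool) (f : ℕ → W) (l : ℕ) :
    readAddress x ((List.range l).map f) =
      ∑ i ∈ Finset.range l, if x (f i) = true then 2 ^ (l - 1 - i) else 0 := by
  induction l generalizing f with
  | zero => simp [readAddress]
  | succ l ih =>
    rw [List.range_succ_eq_map, Finset.sum_range_succ']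
    simp only [List.map_cons, List.map_map, readAddress, List.length_map, List.length_range]
    rw [ih (f ∘ Nat.succ), add_comm]
    congr 1
    refine Finset.sum_congr rfl fun i hi => ?_
    have : l - 1 - i = l + 1 - 1 - (i + 1) := by omega
    simp [this]

end ReadAddress

section Semantics

variable {W : Type} [Fintype W] [DecidableEq W] {lo hi : ℕ} {leaf : ℕ → Option W → Circuit W}
  {mask : ℕ → W → Bool} {ε : ℕ → ℤˣ} {ph : W} {S : W → Prop}

/-- The leaf of address `A` flips the bits in `mask A` and applies `ε A`. The qubits in `S` include
all controls and ancillas; masks avoid `S`, so every subtree returns them unchanged and the subtrees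
can be composed. At a node whose two halves are both entered, `t` holds `c ∧ ¬d` for the left half,
and the CX gate from `c` turns this into `c ∧ d` for the right one, so one AND gate serves both. By
`hout` a half-interval that is skipped would have acted trivially. -/
theorem unaryBranch_realizes
    (hleaf : ∀ A c x, S c → x ph = true → (leaf A (some c)).Realizes x
      (if x c = true then ε A else 1) (fun w => x w ^^ (x c && mask A w)))
    (hS : ∀ A w, S w → mask A w = false) (hph : ∀ A, mask A ph = false) (hphS : ¬ S ph)
    (hout : ∀ A, ¬ (lo ≤ A ∧ A < hi) → (∀ w, mask A w = false) ∧ ε A = 1) (L : List (W × W)) :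
    ∀ (c : W) (base : ℕ) (x : W → Bool), S c → (∀ p ∈ L, S p.1 ∧ S p.2) →
      (c :: (L.map Prod.fst ++ L.map Prod.snd)).Nodup → x ph = true → (∀ p ∈ L, x p.2 = false) →
      (unaryBranch lo hi leaf c L base).Realizes x
        (if x c = true then ε (base + readAddress x (L.map Prod.fst)) else 1)
        (fun w => x w ^^ (x c && mask (base + readAddress x (L.map Prod.fst)) w)) := by
  induction L with
  | nil =>
    intro c base x hc _ _ hx _
    simpa [unaryBranch, readAddress] using hleaf base c x hc hx
  | cons p rest ih =>
    obtain ⟨d, t⟩ := p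
    intro c base x hc hL hnd hx hanc
    have hSd : S d := (hL (d, t) (by simp)).1
    have hSt : S t := (hL (d, t) (by simp)).2
    have hrest : ∀ p ∈ rest, S p.1 ∧ S p.2 := fun p hp => hL p (by simp [hp])
    have hxt : x t = false := hanc (d, t) (by simp)
    have hcd : c ≠ d := by rintro rfl; simp at hnd
    have hct : c ≠ t := by rintro rfl; simp at hnd
    have hdt : d ≠ t := by rintro rfl; simp at hnd
    have hnd' : (t :: (rest.map Prod.fst ++ rest.map Prod.snd)).Nodup := by
      simp only [List.map_cons, List.cons_append, List.nodup_cons, List.mem_cons, List.mem_append,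
        List.nodup_append] at hnd ⊢
      grind
    have htfst : ∀ e ∈ rest.map Prod.fst, e ≠ t := by
      rintro e he rfl
      exact (List.nodup_cons.1 hnd').1 (List.mem_append_left _ he)
    have htsnd : ∀ p ∈ rest, p.2 ≠ t := by
      rintro p hp rfl
      exact (List.nodup_cons.1 hnd').1 (List.mem_append_right _ (List.mem_map_of_mem hp))
    have hpt : ph ≠ t := by rintro rfl; exact hphS hSt
    set r := readAddress x (rest.map Prod.fst) with hr
    have hrlt : r < 2 ^ rest.length := by
      simpa using readAddress_lt x (rest.map Prod.fst)
    have hread : ∀ y : W → Bool, (∀ w, S w → w ≠ t → y w = x w) →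
        readAddress y (rest.map Prod.fst) = r := by
      intro y hy
      refine readAddress_congr fun e he => hy e ?_ (htfst e he)
      obtain ⟨p, hp, rfl⟩ := List.mem_map.1 he
      exact (hrest p hp).1
    have hsub : ∀ (base : ℕ) (y : W → Bool), (∀ w, S w → w ≠ t → y w = x w) → y ph = true →
        (unaryBranch lo hi leaf t rest base).Realizes y (if y t = true then ε (base + r) else 1)
          (fun w => y w ^^ (y t && mask (base + r) w)) := by
      intro base y hy hyp
      have h := ih t base y hSt hrest hnd' hyp fun p hp => by
        rw [hy _ (hrest p hp).2 (htsnd p hp)]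
        exact hanc p (by simp [hp])
      rwa [hread y hy] at h
    have hval : readAddress x (((d, t) :: rest).map Prod.fst) =
        (if x d = true then 2 ^ rest.length else 0) + r := by
      simp [readAddress, hr]
    rw [hval]
    have hskip : ∀ base, ¬ Meets lo hi base (2 ^ rest.length) →
        (∀ w, mask (base + r) w = false) ∧ ε (base + r) = 1 := by
      intro base h
      exact hout _ fun hA => h (by simp only [Meets]; omega)
    have hand : ∀ b, (Circuit.Realizes [.andGate c d b t] x 1
        (Function.update x t (x c && (x d == b)))) := fun b =>
      .andGate ⟨hcd, hct, hdt⟩ hxt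
    have hS' : ∀ A (y : W → Bool) (b : Bool) w, S w → (y w ^^ (b && mask A w)) = y w := by
      intro A y b w hw
      simp [hS A w hw]
    have hadj : ∀ (b : Bool) (y : W → Bool), (∀ w, S w → w ≠ t → y w = x w) →
        y t = (x c && (x d == b)) → Circuit.Realizes [.andAdj c d b t] y 1
        (Function.update y t false) := by
      intro b y hy hyt
      refine .andAdj ⟨hcd, hct, hdt⟩ ?_
      rw [hyt, hy c hc hct, hy d hSd hdt]
    have hx1 : ∀ v w, S w → w ≠ t → Function.update x t v w = x w := fun v w _ hw => by simp [hw]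
    have hsingle : ∀ (b : Bool) (base : ℕ), Circuit.Realizes
        ([.andGate c d b t] ++ unaryBranch lo hi leaf t rest base ++ [.andAdj c d b t]) x
        (if (x c && (x d == b)) = true then ε (base + r) else 1)
        (fun w => x w ^^ ((x c && (x d == b)) && mask (base + r) w)) := by
      intro b base
      have h1 := hsub base _ (hx1 (x c && (x d == b))) (by simpa [hpt] using hx)
      have h2 := ((hand b).append h1).append (hadj b _ (fun w hw hwt => by
        rw [hS' _ _ _ w hw, hx1 _ w hw hwt]) (by rw [hS' _ _ _ t hSt]; simp))
      convert h2 using 1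
      · simp
      · funext w
        by_cases hw : w = t
        · subst hw; simp [hS _ _ hSt, hxt]
        · simp [hw]
    simp only [unaryBranch]
    by_cases hm0 : Meets lo hi base (2 ^ rest.length) <;>
      by_cases hm1 : Meets lo hi (base + 2 ^ rest.length) (2 ^ rest.length)
    · rw [if_pos hm0, if_pos hm1]
      have h1 := hsub base _ (hx1 (x c && (x d == false))) (by simpa [hpt] using hx)
      set x1 := Function.update x t (x c && (x d == false)) with hx1d
      set x2 : W → Bool := fun w => x1 w ^^ (x1 t && mask (base + r) w) with hx2d
      have h2 := Circuit.Realizes.rev (g := .cx c t) hct x2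
      have hx2S : ∀ w, S w → x2 w = x1 w := fun w hw => hS' _ _ _ w hw
      set x3 := (RevGate.cx c t).apply x2 with hx3d
      have hx3t : x3 t = (x c && (x d == true)) := by
        have hc2 : x2 c = x c := by rw [hx2S c hc, hx1d]; simp [hct]
        have ht2 : x2 t = (x c && (x d == false)) := by rw [hx2S t hSt, hx1d]; simp
        simp only [hx3d, RevGate.apply, hc2]
        cases hxc : x c <;> cases hxd : x d <;> simp [flipBit, ht2, hxc, hxd]
      have hx3ne : ∀ w, w ≠ t → x3 w = x2 w := by
        intro w hw
        simp only [hx3d, RevGate.apply]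
        split_ifs
        · simp [flipBit, hw]
        · rfl
      have hx3S : ∀ w, S w → w ≠ t → x3 w = x w := fun w hw hwt => by
        rw [hx3ne w hwt, hx2S w hw, hx1d]; simp [hwt]
      have hx3p : x3 ph = true := by
        rw [hx3ne ph hpt]
        simp [hx2d, hph, hx1d, hpt, hx]
      have h3 := hsub (base + 2 ^ rest.length) x3 hx3S hx3p
      have h4 := ((((hand false).append h1).append h2).append h3).append
        (hadj true _ (fun w hw hwt => by rw [hS' _ _ _ w hw, hx3S w hw hwt])
          (by rw [hS' _ _ _ t hSt, hx3t]))
      convert h4 using 1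
      · rw [hx3t, hx1d]
        cases x c <;> cases x d <;> simp [add_assoc]
      · funext w
        by_cases hw : w = t
        · subst hw; simp [hS _ _ hSt, hxt]
        · have : x3 w = (x w ^^ ((x c && (x d == false)) && mask (base + r) w)) := by
            rw [hx3ne w hw]; simp [hx2d, hx1d, hw]
          rw [Function.update_of_ne hw, this, hx3t]
          cases x c <;> cases x d <;> simp [add_assoc]
    · rw [if_pos hm0, if_neg hm1]
      convert hsingle false base using 1
      · have := hskip _ hm1
        cases x c <;> cases x d <;> simp [← add_assoc, this]
      · have := hskip _ hm1
        cases x c <;> cases x d <;> simp [← add_assoc, this]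
    · rw [if_neg hm0, if_pos hm1]
      convert hsingle true (base + 2 ^ rest.length) using 1
      · have := hskip _ hm0
        cases x c <;> cases x d <;> simp [← add_assoc, this]
      · have := hskip _ hm0
        cases x c <;> cases x d <;> simp [← add_assoc, this]
    · rw [if_neg hm0, if_neg hm1]
      have e0 := hskip _ hm0
      have e1 := hskip _ hm1
      convert Circuit.Realizes.nil x using 1
      · cases x c <;> cases x d <;> simp [← add_assoc, e0, e1]
      · cases x c <;> cases x d <;> simp [← add_assoc, e0, e1]

/-- The root needs no AND gate: the first address qubit is itself the control, conjugated by `X` for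
the left half. An empty register has the single address `0`, whose leaf is uncontrolled. -/
theorem restrictedPUI_realizes
    (hleaf₀ : ∀ A x, x ph = true → (leaf A none).Realizes x (ε A) (fun w => x w ^^ mask A w))
    (hleaf : ∀ A c x, S c → x ph = true → (leaf A (some c)).Realizes x
      (if x c = true then ε A else 1) (fun w => x w ^^ (x c && mask A w)))
    (hS : ∀ A w, S w → mask A w = false) (hph : ∀ A, mask A ph = false) (hphS : ¬ S ph)
    (hout : ∀ A, ¬ (lo ≤ A ∧ A < hi) → (∀ w, mask A w = false) ∧ ε A = 1) {addr anc : List W}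
    (haddr : ∀ w ∈ addr, S w) (hancS : ∀ w ∈ anc, S w) (hlen : anc.length = addr.length - 1)
    (hnd : (addr ++ anc).Nodup) {x : W → Bool} (hx : x ph = true)
    (hanc : ∀ w ∈ anc, x w = false) :
    (restrictedPUI lo hi leaf addr anc).Realizes x (ε (readAddress x addr))
      (fun w => x w ^^ mask (readAddress x addr) w) := by
  cases addr with
  | nil => simpa [restrictedPUI, readAddress] using hleaf₀ 0 x hx
  | cons d rest =>
    have hl : rest.length = anc.length := by simpa using hlen.symm
    have hfst : (rest.zip anc).map Prod.fst = rest := List.map_fst_zip hl.le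
    have hsnd : (rest.zip anc).map Prod.snd = anc := List.map_snd_zip hl.ge
    have hSd : S d := haddr d (by simp)
    have hpd : ph ≠ d := by rintro rfl; exact hphS hSd
    have hdr : d ∉ rest ∧ d ∉ anc := by
      simpa [List.nodup_cons] using (List.nodup_cons.1 hnd).1
    set r := readAddress x rest with hr
    have hrlt : r < 2 ^ rest.length := readAddress_lt x rest
    have hsub : ∀ (base : ℕ) (y : W → Bool), (∀ w, S w → w ≠ d → y w = x w) → y ph = true →
        (unaryBranch lo hi leaf d (rest.zip anc) base).Realizes y
          (if y d = true then ε (base + r) else 1)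
          (fun w => y w ^^ (y d && mask (base + r) w)) := by
      intro base y hy hyp
      have h := unaryBranch_realizes hleaf hS hph hphS hout (rest.zip anc) d base y hSd
        (fun p hp => ⟨haddr _ (by simp [(List.of_mem_zip hp).1]), hancS _ (List.of_mem_zip hp).2⟩)
        (by rw [hfst, hsnd]; exact hnd) hyp (fun p hp => by
          have hp' := (List.of_mem_zip hp).2
          rw [hy _ (hancS _ hp') (by rintro h; exact hdr.2 (h ▸ hp'))]
          exact hanc _ hp')
      rw [hfst] at h
      rwa [readAddress_congr (y := x) fun e he =>
        hy e (haddr e (by simp [he])) (by rintro rfl; exact hdr.1 he)] at h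
    have hskip : ∀ base, ¬ Meets lo hi base (2 ^ rest.length) →
        (∀ w, mask (base + r) w = false) ∧ ε (base + r) = 1 := by
      intro base h
      exact hout _ fun hA => h (by simp only [Meets]; omega)
    have hleft : Circuit.Realizes (if Meets lo hi 0 (2 ^ rest.length) then
        [.gate (.rev (.x d))] ++ unaryBranch lo hi leaf d (rest.zip anc) 0 ++
          [.gate (.rev (.x d))] else []) x
        (if x d = true then 1 else ε (0 + r)) (fun w => x w ^^ (!x d && mask (0 + r) w)) := by
      by_cases hm : Meets lo hi 0 (2 ^ rest.length)
      · rw [if_pos hm]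
        have h1 := Circuit.Realizes.rev (g := .x d) trivial x
        have h2 := hsub 0 (flipBit d x) (fun w _ hw => RevGate.flipBit_ne hw x)
          (by rw [RevGate.flipBit_ne hpd, hx])
        have h3 := Circuit.Realizes.rev (g := .x d) trivial
          (fun w => flipBit d x w ^^ (flipBit d x d && mask (0 + r) w))
        convert (h1.append h2).append h3 using 1
        · rw [RevGate.flipBit_self]; cases x d <;> simp
        · funext w
          by_cases hw : w = d
          · subst hw; simp [RevGate.apply, RevGate.flipBit_self, hS _ _ hSd]
          · simp [RevGate.apply, RevGate.flipBit_self, RevGate.flipBit_ne hw]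
      · rw [if_neg hm]
        have := hskip _ hm
        convert Circuit.Realizes.nil x using 1
        · cases x d <;> simp only [this] <;> simp
        · simp only [this]; simp
    -- The right half starts from the output of the left half, which agrees with `x` on `S` only.
    have hright : ∀ y : W → Bool, (∀ w, S w → y w = x w) → y ph = true →
        Circuit.Realizes (if Meets lo hi (2 ^ rest.length) (2 ^ rest.length) then
          unaryBranch lo hi leaf d (rest.zip anc) (2 ^ rest.length) else []) y
        (if x d = true then ε (2 ^ rest.length + r) else 1)
        (fun w => y w ^^ (x d && mask (2 ^ rest.length + r) w)) := by
      intro y hy hyp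
      by_cases hm : Meets lo hi (2 ^ rest.length) (2 ^ rest.length)
      · rw [if_pos hm]
        have h := hsub (2 ^ rest.length) y (fun w hw _ => hy w hw) hyp
        rw [hy d hSd] at h
        exact h
      · rw [if_neg hm]
        have := hskip _ hm
        convert Circuit.Realizes.nil y using 1
        · cases x d <;> simp only [this] <;> simp
        · simp only [this]; simp
    have h := hleft.append (hright _ (fun w hw => by simp [hS _ _ hw]) (by simp [hph, hx]))
    simp only [restrictedPUI, readAddress, ← hr]
    convert h using 1
    · cases x d <;> simp
    · cases x d <;> simp

end Semantics

/-! ### Validity of the partial unary iteration -/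

section Validity

variable {W : Type} {lo hi : ℕ} {leaf : ℕ → Option W → Circuit W}

theorem unaryBranch_valid {S : W → Prop} (hleaf : ∀ A c, S c → (leaf A (some c)).Valid)
    (L : List (W × W)) :
    ∀ (c : W) (base : ℕ), S c → (∀ p ∈ L, S p.1 ∧ S p.2) →
      (c :: (L.map Prod.fst ++ L.map Prod.snd)).Nodup →
      (unaryBranch lo hi leaf c L base).Valid := by
  induction L with
  | nil => intro c base hc _ _; exact hleaf base c hc
  | cons p rest ih =>
    obtain ⟨d, t⟩ := p
    intro c base hc hL hnd
    have hcd : c ≠ d := by rintro rfl; simp at hnd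
    have hct : c ≠ t := by rintro rfl; simp at hnd
    have hdt : d ≠ t := by rintro rfl; simp at hnd
    have hnd' : (t :: (rest.map Prod.fst ++ rest.map Prod.snd)).Nodup := by
      simp only [List.map_cons, List.cons_append, List.nodup_cons, List.mem_cons, List.mem_append,
        List.nodup_append] at hnd ⊢
      grind
    have h := fun base => ih t base (hL (d, t) (by simp)).2 (fun p hp => hL p (by simp [hp])) hnd'
    simp only [unaryBranch]
    split_ifs <;>
      simp only [Circuit.valid_append, Circuit.valid_singleton, Circuit.valid_nil, h,
        Instr.Valid, QGate.Valid, RevGate.Valid, ne_eq, hcd, hct, hdt, not_false_eq_true,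
        and_self]

theorem restrictedPUI_valid {S : W → Prop} (hleaf₀ : ∀ A, (leaf A none).Valid)
    (hleaf : ∀ A c, S c → (leaf A (some c)).Valid) {addr anc : List W}
    (haddr : ∀ w ∈ addr, S w) (hancS : ∀ w ∈ anc, S w) (hlen : anc.length = addr.length - 1)
    (hnd : (addr ++ anc).Nodup) : (restrictedPUI lo hi leaf addr anc).Valid := by
  cases addr with
  | nil => exact hleaf₀ 0
  | cons d rest =>
    have hl : rest.length = anc.length := by simpa using hlen.symm
    have h := fun base => unaryBranch_valid (lo := lo) (hi := hi) hleaf (rest.zip anc) d base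
      (haddr d (by simp))
      (fun p hp => ⟨haddr _ (by simp [(List.of_mem_zip hp).1]), hancS _ (List.of_mem_zip hp).2⟩)
      (by rw [List.map_fst_zip hl.le, List.map_snd_zip hl.ge]; exact hnd)
    simp only [restrictedPUI]
    split_ifs <;>
      simp only [Circuit.valid_append, Circuit.valid_singleton, Circuit.valid_nil, h,
        Instr.Valid, QGate.Valid, RevGate.Valid, and_self]

end Validity

/-! ### Toffoli count of the partial unary iteration -/

section ToffoliCount

variable {W : Type} {lo hi : ℕ} {leaf : ℕ → Option W → Circuit W}

theorem unaryBranch_toffoli_inverse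
    (hleaf : ∀ A c, (leaf A c).inverse.toffoli = (leaf A c).toffoli) (L : List (W × W)) :
    ∀ (c : W) (base : ℕ), (unaryBranch lo hi leaf c L base).inverse.toffoli =
      (unaryBranch lo hi leaf c L base).toffoli := by
  induction L with
  | nil => intro c base; exact hleaf base _
  | cons p rest ih =>
    intro c base
    simp only [unaryBranch]
    split_ifs <;> simp only [Circuit.inverse_append, Circuit.inverse_nil,
      Circuit.toffoli_append, ih] <;>
      simp [Circuit.inverse, Circuit.toffoli, Instr.inverse, Instr.toffoli, QGate.toffoli] <;> ring

theorem restrictedPUI_toffoli_inverse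
    (hleaf : ∀ A c, (leaf A c).inverse.toffoli = (leaf A c).toffoli) (addr anc : List W) :
    (restrictedPUI lo hi leaf addr anc).inverse.toffoli =
      (restrictedPUI lo hi leaf addr anc).toffoli := by
  cases addr with
  | nil => exact hleaf 0 none
  | cons d rest =>
    simp only [restrictedPUI]
    split_ifs <;> simp only [Circuit.inverse_append, Circuit.inverse_nil,
      Circuit.toffoli_append, unaryBranch_toffoli_inverse hleaf] <;>
      simp [Circuit.inverse, Circuit.toffoli, Instr.inverse, Instr.toffoli, QGate.toffoli] <;> ring

/-- Each inner node of a binary tree with `2 ^ L.length` leaves costs at most one AND gate. -/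
theorem unaryBranch_toffoli_le (hleaf : ∀ A c, (leaf A c).toffoli = 0) (L : List (W × W)) :
    ∀ (c : W) (base : ℕ), (unaryBranch lo hi leaf c L base).toffoli + 1 ≤ 2 ^ L.length := by
  induction L with
  | nil => intro c base; simp [unaryBranch, hleaf]
  | cons p rest ih =>
    intro c base
    have h1 := ih p.2 base
    have h2 := ih p.2 (base + 2 ^ rest.length)
    simp only [unaryBranch, List.length_cons, pow_succ]
    split_ifs <;> simp only [Circuit.toffoli_append, Circuit.toffoli_nil] <;>
      simp [Circuit.toffoli, Instr.toffoli, QGate.toffoli] at h1 h2 ⊢ <;> omega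

/-- An interval inside an aligned block of length `2 ^ μ` meets only one half of each larger aligned
interval. So the upper `L.length - μ` levels cost at most one AND gate each, and the remaining
subtree at most `2 ^ μ - 1`. -/
theorem unaryBranch_toffoli_le_of_aligned (hleaf : ∀ A c, (leaf A c).toffoli = 0) {μ : ℕ}
    (hlo : 2 ^ μ ∣ lo) (hhi : hi ≤ lo + 2 ^ μ) (L : List (W × W)) (hμ : μ ≤ L.length) :
    ∀ (c : W) (base : ℕ), 2 ^ L.length ∣ base →
      (unaryBranch lo hi leaf c L base).toffoli + 1 + μ ≤ L.length + 2 ^ μ := by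
  induction L with
  | nil =>
    intro c base _
    obtain rfl : μ = 0 := by simpa using hμ
    simp [unaryBranch, hleaf]
  | cons p rest ih =>
    intro c base hbase
    rcases hμ.eq_or_lt with h | h
    · have := unaryBranch_toffoli_le (lo := lo) (hi := hi) hleaf (p :: rest) c base
      rw [h]; omega
    have hμ' : μ ≤ rest.length := by simpa [Nat.lt_succ_iff] using h
    have hd : 2 ^ rest.length ∣ base :=
      (pow_dvd_pow 2 (by simp)).trans hbase
    have h1 := ih hμ' p.2 base hd
    have h2 := ih hμ' p.2 (base + 2 ^ rest.length) (hd.add (dvd_refl _))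
    have hpos : 1 ≤ 2 ^ μ := Nat.one_le_two_pow
    simp only [unaryBranch, List.length_cons]
    split_ifs with hm1 hm2 hm2
    -- If both halves met `[lo, hi)`, the midpoint, a multiple of `2 ^ μ`, would lie strictly
    -- between the consecutive multiples `lo` and `lo + 2 ^ μ`.
    · exfalso
      obtain ⟨q, hq⟩ : 2 ^ μ ∣ base + 2 ^ rest.length :=
        (pow_dvd_pow 2 hμ').trans (hd.add (dvd_refl _))
      obtain ⟨q', rfl⟩ := hlo
      simp only [Meets] at hm1 hm2
      have a1 : 2 ^ μ * q' < 2 ^ μ * q := by omega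
      have a2 : 2 ^ μ * q < 2 ^ μ * (q' + 1) := by rw [mul_add, mul_one]; omega
      have := Nat.lt_of_mul_lt_mul_left a1
      have := Nat.lt_of_mul_lt_mul_left a2
      omega
    all_goals
      simp only [Circuit.toffoli_append, Circuit.toffoli_nil]
      simp [Circuit.toffoli, Instr.toffoli] at h1 h2 ⊢
      omega

/-- The level of the root is free, which saves one gate. If the block is at least as long as the
whole address range, both halves may be entered, and the full tree costs at most `2 ^ addr.length -
2`. -/
theorem restrictedPUI_toffoli_le (hleaf : ∀ A c, (leaf A c).toffoli = 0) {μ : ℕ}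
    (hlo : 2 ^ μ ∣ lo) (hhi : hi ≤ lo + 2 ^ μ) {addr anc : List W} (hne : addr ≠ [])
    (hlen : anc.length = addr.length - 1) :
    (restrictedPUI lo hi leaf addr anc).toffoli + 2 + μ ≤ addr.length + 2 ^ μ := by
  cases addr with
  | nil => exact absurd rfl hne
  | cons d rest =>
    have hl : (rest.zip anc).length = rest.length := by
      rw [List.length_zip, hlen]; simp
    rcases le_or_gt μ rest.length with hμ | hμ
    · have h := fun base hb => unaryBranch_toffoli_le_of_aligned hleaf hlo hhi (rest.zip anc)
        (by rw [hl]; exact hμ) d base hb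
      have h1 := h 0 (dvd_zero _)
      have h2 := h (2 ^ rest.length) (by rw [hl])
      have hpos : 1 ≤ 2 ^ μ := Nat.one_le_two_pow
      rw [hl] at h1 h2
      simp only [restrictedPUI, List.length_cons]
      split_ifs with hm1 hm2 hm2
      · exfalso
        obtain ⟨q, hq⟩ : 2 ^ μ ∣ 2 ^ rest.length := pow_dvd_pow 2 hμ
        obtain ⟨q', rfl⟩ := hlo
        simp only [Meets] at hm1 hm2
        have a1 : 2 ^ μ * q' < 2 ^ μ * q := by omega
        have a2 : 2 ^ μ * q < 2 ^ μ * (q' + 1) := by rw [mul_add, mul_one]; omega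
        have := Nat.lt_of_mul_lt_mul_left a1
        have := Nat.lt_of_mul_lt_mul_left a2
        omega
      all_goals
        simp only [Circuit.toffoli_append, Circuit.toffoli_nil]
        simp [Circuit.toffoli, Instr.toffoli, QGate.toffoli] at h1 h2 ⊢
        omega
    · have h := unaryBranch_toffoli_le (lo := lo) (hi := hi) hleaf (rest.zip anc) d
      have h1 := h 0
      have h2 := h (2 ^ rest.length)
      rw [hl] at h1 h2
      -- Monotonicity of `2 ^ x - x`, applied to `rest.length + 1 ≤ μ`.
      have key : 2 ^ (rest.length + 1) + μ ≤ 2 ^ μ + (rest.length + 1) := by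
        obtain ⟨e, rfl⟩ : ∃ e, μ = rest.length + 1 + e := ⟨μ - (rest.length + 1), by omega⟩
        have he : e + 1 ≤ 2 ^ e := Nat.lt_two_pow_self
        have hp : 1 ≤ 2 ^ (rest.length + 1) := Nat.one_le_two_pow
        rw [pow_add 2 (rest.length + 1) e]
        nlinarith
      rw [pow_succ] at key
      simp only [restrictedPUI, List.length_cons]
      split_ifs <;> simp only [Circuit.toffoli_append, Circuit.toffoli_nil] <;>
        simp [Circuit.toffoli, Instr.toffoli, QGate.toffoli] at h1 h2 ⊢ <;> omega

end ToffoliCount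

/-! ### Rows and wires -/

section Rows

variable {n s : ℕ}

theorem Row.toWires_injective : Function.Injective (Row.toWires (n := n) s) := by
  intro x y h
  funext i
  exact congrFun h (.col i)

theorem flipBit_toWires (t : Fin (n + 1)) (x : Row n) :
    flipBit (.col t) (x.toWires s) = Row.toWires s (flipBit t x) := by
  funext w
  cases w with
  | col i =>
    by_cases h : i = t
    · subst h; simp [flipBit, Row.toWires]
    · simp [flipBit, Row.toWires, h]
  | phase => simp [flipBit, Row.toWires]
  | anc i => simp [flipBit, Row.toWires]

theorem apply_map_toWires (g : RevGate (Fin (n + 1))) (x : Row n) :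
    (g.map Wire.col).apply (x.toWires s) = Row.toWires s (g.apply x) := by
  cases g with
  | x t => exact flipBit_toWires t x
  | cx c t =>
    simp only [RevGate.map, RevGate.apply, flipBit_toWires, apply_ite (Row.toWires s)]
    rfl
  | swap p q =>
    funext w
    simp only [RevGate.map, RevGate.apply, Function.comp, Row.toWires, Equiv.swap_apply_def]
    cases w <;> simp
    split_ifs <;> simp_all
  | ccx u v b t =>
    simp only [RevGate.map, RevGate.apply, flipBit_toWires, apply_ite (Row.toWires s)]
    rfl

theorem realizes_map_col {gs : List (RevGate (Fin (n + 1)))} (hgs : ∀ g ∈ gs, g.Valid)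
    (x : Row n) :
    Circuit.Realizes (gs.map fun g => .gate (.rev (g.map Wire.col))) (x.toWires s) 1
      (Row.toWires s (gs.foldl (fun x g => g.apply x) x)) := by
  induction gs generalizing x with
  | nil => exact .nil _
  | cons g gs ih =>
    have h1 := Circuit.Realizes.rev (W := Wire n s)
      ((hgs g (by simp)).map (e := Wire.col) fun _ _ h => by simpa using h) (x.toWires s)
    rw [apply_map_toWires] at h1
    simpa using h1.append (ih (fun g hg => hgs g (by simp [hg])) (g.apply x))

theorem valid_map_col {gs : List (RevGate (Fin (n + 1)))} (hgs : ∀ g ∈ gs, g.Valid) :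
    Circuit.Valid (gs.map fun g => (.gate (.rev (g.map Wire.col)) : Instr (Wire n s))) := by
  intro i hi
  obtain ⟨g, hg, rfl⟩ := List.mem_map.1 hi
  exact (hgs g hg).map fun _ _ h => by simpa using h

theorem inverse_toffoli_map_gate {V W : Type} (f : V → QGate W) (gs : List V) :
    (Circuit.inverse (gs.map fun g => .gate (f g))).toffoli =
      Circuit.toffoli (gs.map fun g => .gate (f g)) := by
  simp [Circuit.inverse, Circuit.toffoli, Function.comp_def, Instr.inverse]

theorem colIdx_val {i : ℕ} (h : i ≤ n) : (colIdx n i : ℕ) = i := by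
  simp [colIdx, Fin.ofNat, Nat.mod_eq_of_lt (Nat.lt_succ_of_le h)]

theorem colIdx_coe (i : Fin (n + 1)) : colIdx n i = i :=
  Fin.ext (colIdx_val (Nat.lt_succ_iff.1 i.2))

theorem address_eq_sum (hl : subspaceQubits s ≤ n) (x : Row n) :
    address s x = ∑ i ∈ Finset.range (subspaceQubits s),
      if x (colIdx n i) = true then 2 ^ (subspaceQubits s - 1 - i) else 0 := by
  have h := Finset.sum_range (n := n + 1) fun i => if i < subspaceQubits s ∧
    x (colIdx n i) = true then 2 ^ (subspaceQubits s - 1 - i) else 0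
  simp only [colIdx_coe] at h
  rw [address, ← h]
  symm
  refine Finset.sum_subset_zero_on_sdiff (Finset.range_subset_range.2 (by omega)) ?_ ?_
  · intro i hi
    simp only [Finset.mem_sdiff, Finset.mem_range] at hi
    simp [hi.2]
  · intro i hi
    simp [Finset.mem_range.1 hi]

theorem address_eq_readAddress (hl : subspaceQubits s ≤ n) (x : Row n) :
    address s x = readAddress (x.toWires s)
      ((List.range (subspaceQubits s)).map fun i => .col (colIdx n i)) := by
  rw [address_eq_sum hl, readAddress_map_range]
  rfl

theorem address_congr {x y : Row n} (h : ∀ i : Fin (n + 1), (i : ℕ) < subspaceQubits s → x i = y i) :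
    address s x = address s y := by
  refine Finset.sum_congr rfl fun i _ => ?_
  by_cases hi : (i : ℕ) < subspaceQubits s
  · simp [h i hi]
  · simp [hi]

theorem eq_of_address_eq (hl : subspaceQubits s ≤ n) {x y : Row n}
    (h : address s x = address s y) (i : Fin (n + 1)) (hi : (i : ℕ) < subspaceQubits s) :
    x i = y i := by
  rw [address_eq_readAddress hl, address_eq_readAddress hl] at h
  have := eq_of_readAddress_eq h (.col (colIdx n i))
    (List.mem_map.2 ⟨i, by simpa using hi, rfl⟩)
  rwa [colIdx_coe] at this

theorem sum_testBit (k l : ℕ) :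
    ∑ i ∈ Finset.range l, (if k.testBit i = true then 2 ^ i else 0) = k % 2 ^ l := by
  induction l with
  | zero => simp [Nat.mod_one]
  | succ l ih =>
    rw [Finset.sum_range_succ, ih, Nat.mod_pow_succ, Nat.testBit_eq_decide_div_mod_eq]
    rcases Nat.mod_two_eq_zero_or_one (k / 2 ^ l) with h | h <;> simp [h]

theorem address_subspaceRow (hl : subspaceQubits s ≤ n) {k : ℕ} (hk : k < s) :
    address s (subspaceRow n s k) = k := by
  rw [address_eq_sum hl]
  have hk' : k < 2 ^ subspaceQubits s := hk.trans_le (Nat.le_pow_clog (by norm_num) s)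
  -- The register is big-endian and `sum_testBit` little-endian, hence the reflection.
  conv_rhs => rw [← Nat.mod_eq_of_lt hk', ← sum_testBit, ← Finset.sum_range_reflect]
  refine Finset.sum_congr rfl fun i hi => ?_
  have hi' := Finset.mem_range.1 hi
  simp [subspaceRow, Nat.mod_eq_of_lt (show i < n + 1 by omega), hi']

theorem subspaceRow_of_le {k : ℕ} {u : Fin (n + 1)} (hu : subspaceQubits s ≤ (u : ℕ)) :
    subspaceRow n s k u = false := by
  simp [subspaceRow, Nat.not_lt.2 hu]

theorem batchSize_pos : 0 < batchSize n s := by positivity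

theorem batchSize_le (hsn : subspaceQubits s < n) : batchSize n s ≤ n - subspaceQubits s :=
  Nat.pow_log_le_self 2 (by omega)

end Rows

/-! ### Gates of a batch extension -/

section Extension

variable {V : Type} [DecidableEq V]

/-- The control is not a target, so its value is the same for all the gates, and distinct targets
are flipped only once. -/
theorem foldl_cx (p : V) {ts : List V} (hnd : ts.Nodup) (hp : p ∉ ts) (x : V → Bool) :
    (ts.map fun i => RevGate.cx p i).foldl (fun x g => g.apply x) x =
      if x p = true then fun i => if i ∈ ts then !x i else x i else x := by
  induction ts generalizing x with
  | nil => simp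
  | cons t ts ih =>
    have ht : t ∉ ts := (List.nodup_cons.1 hnd).1
    have hpt : p ≠ t := fun h => hp (by simp [h])
    simp only [List.map_cons, List.foldl_cons]
    rw [ih (List.nodup_cons.1 hnd).2 fun h => hp (by simp [h])]
    by_cases hx : x p = true
    · have e : (RevGate.cx p t).apply x = flipBit t x := by simp [RevGate.apply, hx]
      rw [e, RevGate.flipBit_ne hpt, if_pos hx, if_pos hx]
      funext i
      by_cases hi : i = t
      · subst hi; simp [ht, RevGate.flipBit_self]
      · simp [hi, RevGate.flipBit_ne hi]
    · simp [RevGate.apply, hx]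

theorem comp_swap_eq {p q : V} {x : V → Bool} (h : x p = x q) : x ∘ Equiv.swap p q = x := by
  funext w
  simp only [Function.comp, Equiv.swap_apply_def]
  split_ifs with h1 h2 <;> simp_all

end Extension

namespace Config

variable {n s : ℕ}

/-- Induction over prefixes of `counter`. A row whose only `1` among the batch columns is in slot
`t₀` triggers at most the gate of that slot, which is present only if the batch element there has
flag `1`. A value `t₀ ≥ c.batch.length` describes a row without such a `1`. -/
theorem foldl_counter_aux (c : Config n s)
    (hb : subspaceQubits s + c.batch.length < n) (x : Row n) (t₀ : ℕ)
    (hx : ∀ t < c.batch.length, x (colIdx n (subspaceQubits s + t)) = true ↔ t = t₀) (T : ℕ)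
    (hT : T ≤ c.batch.length) :
    ((List.range T).filterMap fun t =>
      match c.batch[t]? with
      | some i => if c.row i (Fin.last n) = true
          then some (RevGate.cx (colIdx n (subspaceQubits s + t)) c.pivot) else none
      | none => none).foldl (fun x g => g.apply x) x =
      if t₀ < T ∧ ∃ i, c.batch[t₀]? = some i ∧ c.row i (Fin.last n) = true
      then flipBit c.pivot x else x := by
  induction T with
  | zero => simp
  | succ T ih =>
    have hTb : T < c.batch.length := hT
    rw [List.range_succ, List.filterMap_append, List.foldl_append, ih hTb.le]
    have hne : colIdx n (subspaceQubits s + T) ≠ c.pivot := by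
      intro h
      have := congrArg Fin.val h
      rw [colIdx_val (by omega), colIdx_val (by omega)] at this
      omega
    have hxT := hx T hTb
    simp only [List.filterMap_cons, List.filterMap_nil]
    by_cases hD : c.row c.batch[T] (Fin.last n) = true
    · simp only [List.getElem?_eq_getElem hTb, hD, if_true, List.foldl_cons, List.foldl_nil,
        RevGate.apply]
      by_cases h0 : T = t₀
      · subst h0
        have hT' : ¬ (T < T ∧ ∃ i, c.batch[T]? = some i ∧ c.row i (Fin.last n) = true) :=
          fun h => lt_irrefl _ h.1
        rw [if_neg hT', if_pos (hxT.2 rfl), if_pos ⟨Nat.lt_succ_self T, _, List.getElem?_eq_getElem hTb, hD⟩]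
      · have hc : (t₀ < T + 1 ∧ ∃ i, c.batch[t₀]? = some i ∧ c.row i (Fin.last n) = true) ↔
            (t₀ < T ∧ ∃ i, c.batch[t₀]? = some i ∧ c.row i (Fin.last n) = true) := by
          refine and_congr_left' ?_; omega
        have hf : x (colIdx n (subspaceQubits s + T)) ≠ true := fun h => h0 (hxT.1 h)
        rw [if_congr hc rfl rfl]
        by_cases h1 : t₀ < T ∧ ∃ i, c.batch[t₀]? = some i ∧ c.row i (Fin.last n) = true
        · rw [if_pos h1, RevGate.flipBit_ne hne, if_neg hf]
        · rw [if_neg h1, if_neg hf]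
    · have hc : (t₀ < T + 1 ∧ ∃ i, c.batch[t₀]? = some i ∧ c.row i (Fin.last n) = true) ↔
          (t₀ < T ∧ ∃ i, c.batch[t₀]? = some i ∧ c.row i (Fin.last n) = true) := by
        refine ⟨fun ⟨h1, i, h2, h3⟩ => ⟨?_, i, h2, h3⟩, fun ⟨h1, h2⟩ => ⟨by omega, h2⟩⟩
        rcases Nat.lt_succ_iff_lt_or_eq.1 h1 with h | rfl
        · exact h
        · rw [List.getElem?_eq_getElem hTb] at h2
          cases h2
          exact absurd h3 hD
      simp only [List.getElem?_eq_getElem hTb, hD, hc]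
      rfl

theorem foldl_counter (c : Config n s)
    (hb : subspaceQubits s + c.batch.length < n) (x : Row n) (t₀ : ℕ)
    (hx : ∀ t < c.batch.length, x (colIdx n (subspaceQubits s + t)) = true ↔ t = t₀) :
    c.counter.foldl (fun x g => g.apply x) x =
      if ∃ i, c.batch[t₀]? = some i ∧ c.row i (Fin.last n) = true
      then flipBit c.pivot x else x := by
  refine (foldl_counter_aux c hb x t₀ hx _ le_rfl).trans ?_
  refine if_congr ⟨fun h => h.2, fun h => ⟨?_, h⟩⟩ rfl rfl
  obtain ⟨i, hi, -⟩ := h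
  exact (List.getElem?_eq_some_iff.1 hi).1

/-! ### The invariant of the algorithm -/

/-- The row is not of the form `|A⟩|0⟩|0⟩`. -/
def Live (s : ℕ) (x : Row n) : Prop :=
  x (Fin.last n) = true ∨
    ∃ u : Fin (n + 1), subspaceQubits s ≤ (u : ℕ) ∧ (u : ℕ) < n ∧ x u = true

/-- The bound on the Toffoli count of the gates of a single batch. -/
def batchBound (n s : ℕ) : ℕ :=
  2 * batchSize n s + subspaceQubits s - Nat.log 2 (n - subspaceQubits s) - 3

/-- The invariants of the algorithm. -/
structure Inv (C : Fin s → Fin n → Bool) (a : Fin s → ℤˣ) (c : Config n s) : Prop where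
  k_le : c.k ≤ s
  batch_le : c.batch.length ≤ batchSize n s
  length_eq : c.batches.flatten.length + c.batch.length = c.k
  nodup : (c.batches.flatten ++ c.batch).Nodup
  done_row : ∀ i ∈ c.batches.flatten, ∃ A < c.lo, c.row i = subspaceRow n s A
  done_sign : ∀ i ∈ c.batches.flatten, c.sign i = 1
  batch_row : ∀ t i, c.batch[t]? = some i → ∀ u, u ≠ Fin.last n →
    c.row i u = (subspaceRow n s (c.lo + t) u || decide ((u : ℕ) = subspaceQubits s + t))
  live : ∀ i ∉ c.batches.flatten ++ c.batch, Live s (c.row i)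
  -- Since signs are their own inverses, `a i * c.sign i` is the part of `a i` that has been applied
  -- already.
  realizes : ∀ i, c.circuit.Realizes
    (Row.toWires s (Fin.snoc (α := fun _ => Bool) (C i) true)) (a i * c.sign i)
    (Row.toWires s (c.row i))
  valid : c.circuit.Valid
  -- While batches are full, `lo` is a multiple of the batch size, which gives the alignment needed
  -- for the Toffoli count. After a short last batch only the two inequalities that determine
  -- `⌈s/m⌉` remain.
  count : c.batches.length * batchSize n s = c.lo ∨ c.k = s ∧ c.batch = [] ∧
    s ≤ c.batches.length * batchSize n s ∧ c.batches.length * batchSize n s < s + batchSize n s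
  toffoli_le : c.circuit.toffoli ≤ c.batches.length * batchBound n s + (c.batch.length - 1)
  toffoli_inverse : c.circuit.inverse.toffoli = c.circuit.toffoli

theorem inv_init (C : Fin s → Fin n → Bool) (a : Fin s → ℤˣ) : Inv C a (init C a) where
  k_le := Nat.zero_le _
  batch_le := Nat.zero_le _
  length_eq := rfl
  nodup := List.nodup_nil
  done_row := by simp [init]
  done_sign := by simp [init]
  batch_row := by simp [init]
  live := by
    intro i _
    left
    simp [init]
  realizes := by
    intro i
    have : a i * (init C a).sign i = 1 := Int.units_mul_self (a i)
    rw [this]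
    exact .nil _
  valid := Circuit.valid_nil
  count := by simp [init, lo]
  toffoli_le := by simp [init, Circuit.toffoli]
  toffoli_inverse := rfl

namespace Inv

variable {C : Fin s → Fin n → Bool} {a : Fin s → ℤˣ} {c : Config n s}

theorem lo_add (h : Inv C a c) : c.lo + c.batch.length = c.k := by
  have := h.length_eq; simp only [lo]; omega

/-- Reversibility keeps the rows distinct. This provides the column `v` of the Toffoli gate, the
liveness after a partial unary iteration and the injectivity of `f`. -/
theorem row_injective (h : Inv C a c) (hC : Function.Injective C) : Function.Injective c.row := by
  intro i j hij
  have h1 := h.realizes i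
  rw [hij] at h1
  have h2 := Row.toWires_injective (h1.source_unique (h.realizes j))
  exact hC (by simpa using congrArg Fin.init h2)

theorem done_false (h : Inv C a c) {i : Fin s} (hi : i ∈ c.batches.flatten) {u : Fin (n + 1)}
    (hu : subspaceQubits s ≤ (u : ℕ)) : c.row i u = false := by
  obtain ⟨A, -, hA⟩ := h.done_row i hi
  rw [hA, subspaceRow_of_le hu]

theorem batch_eq (h : Inv C a c) {t : ℕ} {i : Fin s} (hi : c.batch[t]? = some i)
    {u : Fin (n + 1)} (hu : subspaceQubits s ≤ (u : ℕ)) (hun : (u : ℕ) < n) :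
    c.row i u = decide ((u : ℕ) = subspaceQubits s + t) := by
  rw [h.batch_row t i hi u (by rintro rfl; simp at hun), subspaceRow_of_le hu, Bool.false_or]

theorem seq_false (h : Inv C a c) {i : Fin s} (hi : i ∈ c.batches.flatten ++ c.batch)
    {u : Fin (n + 1)} (hu : subspaceQubits s + c.batch.length ≤ (u : ℕ)) (hun : (u : ℕ) < n) :
    c.row i u = false := by
  rcases List.mem_append.1 hi with hi | hi
  · exact h.done_false hi (by omega)
  · obtain ⟨t, ht⟩ := List.mem_iff_getElem?.1 hi
    have htb := (List.getElem?_eq_some_iff.1 ht).1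
    rw [h.batch_eq ht (by omega) hun]
    simp; omega

end Inv

end Config

/-! ### Extension of the batch -/

namespace Config

variable {n s : ℕ}

/-- The gates that create a `1` in the pivot column of row `j` leave the rows of all batches
unchanged. -/
structure Prepared (c : Config n s) (gs : List (RevGate (Fin (n + 1)))) (j : Fin s) : Prop where
  valid : ∀ g ∈ gs, g.Valid
  seq : ∀ i ∈ c.batches.flatten ++ c.batch, gs.foldl (fun x g => g.apply x) (c.row i) = c.row i
  notMem : j ∉ c.batches.flatten ++ c.batch
  pivot : gs.foldl (fun x g => g.apply x) (c.row j) c.pivot = true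
  live : ∀ i ∉ c.batches.flatten ++ c.batch, Live s (gs.foldl (fun x g => g.apply x) (c.row i))
  -- With truncated subtraction the bound is `0` for an empty batch and `1` otherwise: the increment
  -- of `c.batch.length - 1` in `Inv.toffoli_le`.
  toffoli : (Circuit.toffoli (gs.map fun g =>
    (.gate (.rev (g.map Wire.col)) : Instr (Wire n s)))) ≤ c.batch.length - (c.batch.length - 1)

namespace Inv

variable {C : Fin s → Fin n → Bool} {a : Fin s → ℤˣ} {c : Config n s}

/-- Rows already in batches are `0` in both swapped columns. Both columns belong to register `r`, so
live rows stay live. -/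
theorem prepared_swap (h : Inv C a c) (hb : subspaceQubits s + c.batch.length < n) {j : Fin s}
    {r : Fin (n + 1)} (hr : c.HasFree j r) :
    c.Prepared (if r = c.pivot then [] else [.swap r c.pivot]) j := by
  have hp : (c.pivot : ℕ) = subspaceQubits s + c.batch.length := colIdx_val hb.le
  obtain ⟨hr1, hr2, hr3⟩ := hr
  have hj : j ∉ c.batches.flatten ++ c.batch := fun hj => by
    rw [h.seq_false hj hr1 hr2] at hr3; cases hr3
  by_cases he : r = c.pivot
  · rw [if_pos he]
    exact ⟨by simp, fun _ _ => rfl, hj, he ▸ hr3, h.live,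
      by simp [Circuit.toffoli]⟩
  · rw [if_neg he]
    refine ⟨by simpa [RevGate.Valid] using he, fun i hi => ?_, hj, ?_, fun i hi => ?_,
      by simp [Circuit.toffoli, Instr.toffoli, QGate.toffoli, RevGate.map]⟩
    · change c.row i ∘ Equiv.swap r c.pivot = c.row i
      refine comp_swap_eq ?_
      rw [h.seq_false hi hr1 hr2, h.seq_false hi hp.ge (hp ▸ hb)]
    · simpa [RevGate.apply] using hr3
    · have hlast : ∀ u : Fin (n + 1), (u : ℕ) < n → Fin.last n ≠ u := by
        rintro u hu rfl; simp at hu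
      rcases h.live i hi with hl | ⟨u, hu1, hu2, hu3⟩
      · left
        change c.row i (Equiv.swap r c.pivot (Fin.last n)) = true
        rwa [Equiv.swap_apply_of_ne_of_ne (hlast r hr2) (hlast c.pivot (hp ▸ hb))]
      · refine Or.inr ⟨Equiv.swap r c.pivot u, ?_, ?_, by simpa [RevGate.apply] using hu3⟩ <;>
          rw [Equiv.swap_apply_def] <;> split_ifs <;> omega

/-- Among the rows already in batches only `w` is `1` at `u`, and `w` fails the control at `v`; so
the gate fixes all of them. It sets the pivot of row `j`, which was `0` by `hfree`. Its control `u`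
lies in register `r` and is not changed, so every row on which it acts stays live. -/
theorem prepared_toffoli (h : Inv C a c) (hb : subspaceQubits s + c.batch.length < n)
    (hfree : ∀ i r, ¬ c.HasFree i r) {j : Fin s} {u v : Fin (n + 1)} {w : Fin s}
    (hu : c.Outside j u) (hw : c.batch[(u : ℕ) - subspaceQubits s]? = some w)
    (hv : c.row j v ≠ c.row w v) : c.Prepared [.ccx u v (c.row j v) c.pivot] j := by
  have hp : (c.pivot : ℕ) = subspaceQubits s + c.batch.length := colIdx_val hb.le
  obtain ⟨hu1, hu2, hu3, hu4⟩ := hu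
  have hlen := (List.getElem?_eq_some_iff.1 hw).1
  have hpf : ∀ i, c.row i c.pivot = false := fun i => by
    by_contra hi
    exact hfree i c.pivot ⟨hp.ge, hp ▸ hb, by simpa using hi⟩
  have hup : u ≠ c.pivot := fun e => by have := congrArg Fin.val e; omega
  have hwu : c.row w u = true := by
    rw [h.batch_eq hw hu2 hu3]; simp; omega
  have hj : j ∉ c.batches.flatten ++ c.batch := fun hj => by
    rcases List.mem_append.1 hj with hj | hj
    · rw [h.done_false hj hu2] at hu4; cases hu4
    · exact hu1 hj
  refine ⟨?_, fun i hi => ?_, hj, ?_, fun i hi => ?_, ?_⟩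
  · simp only [List.mem_singleton, forall_eq]
    refine ⟨?_, hup, ?_⟩
    · rintro rfl; rw [hu4, hwu] at hv; exact hv rfl
    · rintro rfl; rw [hpf, hpf] at hv; exact hv rfl
  · simp only [List.foldl_cons, List.foldl_nil, RevGate.apply]
    refine if_neg ?_
    rintro ⟨h1, h2⟩
    rcases List.mem_append.1 hi with hi | hi
    · rw [h.done_false hi hu2] at h1; cases h1
    · obtain ⟨t, ht⟩ := List.mem_iff_getElem?.1 hi
      rw [h.batch_eq ht hu2 hu3, decide_eq_true_eq] at h1
      rw [h1, Nat.add_sub_cancel_left, ht, Option.some_inj] at hw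
      exact hv (by rw [← h2, hw])
  · simp only [List.foldl_cons, List.foldl_nil, RevGate.apply, hu4, and_self, if_true,
      RevGate.flipBit_self, hpf, Bool.not_false]
  · simp only [List.foldl_cons, List.foldl_nil, RevGate.apply]
    split_ifs with h1
    · exact Or.inr ⟨u, hu2, hu3, by rw [RevGate.flipBit_ne hup]; exact h1.1⟩
    · exact h.live i hi
  · simp [Circuit.toffoli, Instr.toffoli, QGate.toffoli, RevGate.map]
    omega

/-- On a batch element with flag `1` the counter gate and the gate controlled on the flag cancel; on
other rows of batches neither acts. All remaining rows are `0` in register `r`, hence have flag `1`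
by liveness, trigger no counter gate and receive a `1` at the pivot. -/
theorem prepared_flag (h : Inv C a c) (hsn : subspaceQubits s < n)
    (hb : subspaceQubits s + c.batch.length < n)
    (hfree : ∀ i r, ¬ c.HasFree i r) (hout : ∀ i u, ¬ c.Outside i u) {j : Fin s}
    (hj : j ∉ c.batch) (hD : c.row j (Fin.last n) = true) :
    c.Prepared (c.counter ++ [.cx (Fin.last n) c.pivot]) j := by
  have hp : (c.pivot : ℕ) = subspaceQubits s + c.batch.length := colIdx_val hb.le
  have hlp : Fin.last n ≠ c.pivot := fun e => by
    have := congrArg Fin.val e; simp only [Fin.val_last] at this; omega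
  have hpf : ∀ i, c.row i c.pivot = false := fun i => by
    by_contra hi
    exact hfree i c.pivot ⟨hp.ge, hp ▸ hb, by simpa using hi⟩
  have hcol : ∀ t < c.batch.length, (colIdx n (subspaceQubits s + t) : ℕ) =
      subspaceQubits s + t := fun t ht => colIdx_val (by omega)
  have hj' : j ∉ c.batches.flatten ++ c.batch := fun hj' => by
    rcases List.mem_append.1 hj' with hj' | hj'
    · rw [h.done_false hj' (by simpa using hsn.le)] at hD; cases hD
    · exact hj hj'
  have hnone : ¬ ∃ i, c.batch[c.batch.length]? = some i ∧ c.row i (Fin.last n) = true := by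
    simp
  have hother : ∀ i ∉ c.batches.flatten ++ c.batch,
      (c.counter ++ [RevGate.cx (Fin.last n) c.pivot]).foldl (fun x g => g.apply x) (c.row i) =
        flipBit c.pivot (c.row i) := by
    intro i hi
    have hi' : i ∉ c.batch := fun hi' => hi (List.mem_append_right _ hi')
    have hlast : c.row i (Fin.last n) = true := by
      rcases h.live i hi with hl | ⟨u, hu1, hu2, hu3⟩
      · exact hl
      · exact absurd ⟨hi', hu1, hu2, hu3⟩ (hout i u)
    -- The slot `c.batch.length` is out of range and stands for a row without a `1` in the batch
    -- columns.
    rw [List.foldl_append, foldl_counter c hb (c.row i) c.batch.length, if_neg hnone]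
    · simp [RevGate.apply, hlast]
    · intro t ht
      refine ⟨fun hx => ?_, fun e => by omega⟩
      exact absurd ⟨hi', by rw [hcol t ht]; omega, by rw [hcol t ht]; omega, hx⟩ (hout i _)
  refine ⟨?_, fun i hi => ?_, hj', ?_, fun i hi => ?_, ?_⟩
  · intro g hg
    rcases List.mem_append.1 hg with hg | hg
    · simp only [counter, List.mem_filterMap, List.mem_range] at hg
      obtain ⟨t, ht, hg⟩ := hg
      rw [List.getElem?_eq_getElem ht] at hg
      simp only [Option.ite_none_right_eq_some, Option.some.injEq] at hg
      rw [← hg.2]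
      intro e
      have := congrArg Fin.val e
      rw [hcol t ht] at this
      omega
    · rw [List.mem_singleton.1 hg]
      exact hlp
  · rcases List.mem_append.1 hi with hi | hi
    · have hl : c.row i (Fin.last n) = false := h.done_false hi (by simpa using hsn.le)
      rw [List.foldl_append, foldl_counter c hb (c.row i) c.batch.length, if_neg hnone]
      · simp [RevGate.apply, hl]
      · intro t ht
        rw [h.done_false hi (by rw [hcol t ht]; omega)]
        simp; omega
    · obtain ⟨t₀, ht₀⟩ := List.mem_iff_getElem?.1 hi
      rw [List.foldl_append, foldl_counter c hb (c.row i) t₀]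
      · simp only [ht₀, Option.some.injEq, exists_eq_left', List.foldl_cons, List.foldl_nil,
          RevGate.apply]
        by_cases hl : c.row i (Fin.last n) = true
        · rw [if_pos hl, RevGate.flipBit_ne hlp, if_pos hl, RevGate.flipBit_flipBit]
        · rw [if_neg hl, if_neg hl]
      · intro t ht
        rw [h.batch_eq ht₀ (by rw [hcol t ht]; omega) (by rw [hcol t ht]; omega), hcol t ht]
        simp
  · rw [hother j hj', RevGate.flipBit_self, hpf]; rfl
  · rw [hother i hi]
    exact Or.inr ⟨c.pivot, by omega, by omega, by rw [RevGate.flipBit_self, hpf]; rfl⟩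
  · have hz : Circuit.toffoli (((c.counter ++ [RevGate.cx (Fin.last n) c.pivot]).map fun g =>
        (.gate (.rev (g.map Wire.col)) : Instr (Wire n s)))) = 0 := by
      rw [Circuit.toffoli, List.sum_eq_zero_iff]
      simp only [List.map_map, List.mem_map]
      rintro _ ⟨g, hg, rfl⟩
      rcases List.mem_append.1 hg with hg | hg
      · simp only [counter, List.mem_filterMap, List.mem_range] at hg
        obtain ⟨t, ht, hg⟩ := hg
        rw [List.getElem?_eq_getElem ht] at hg
        simp only [Option.ite_none_right_eq_some, Option.some.injEq] at hg
        rw [← hg.2]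
        rfl
      · rw [List.mem_singleton.1 hg]
        rfl
    omega

theorem prepared (h : Inv C a c) (hsn : subspaceQubits s < n)
    (hb : subspaceQubits s + c.batch.length < n) {gs : List (RevGate (Fin (n + 1)))} {j : Fin s}
    (hp : c.Prepare gs j) : c.Prepared gs j := by
  cases hp with
  | swap j r hr => exact h.prepared_swap hb hr
  | toffoli hfree j u v w hu hw hv => exact h.prepared_toffoli hb hfree hu hw hv
  | flag hfree hout j hj hD => exact h.prepared_flag hsn hb hfree hout hj hD

/-- Rows already in batches are `0` at the pivot, so the multi-target CX gate fixes them. Any other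
row on which it acts keeps its `1` at the pivot and is therefore live. -/
theorem push (h : Inv C a c) (hsn : subspaceQubits s < n)
    (hb : c.batch.length ≠ batchSize n s) (hk : c.k ≠ s)
    {gs : List (RevGate (Fin (n + 1)))} {j : Fin s} (hp : c.Prepare gs j) :
    Inv C a ((c.append gs).push j) := by
  have hm := batchSize_le hsn
  have hbl := h.batch_le
  have hkl := h.k_le
  have hlo := h.lo_add
  have hbn : subspaceQubits s + c.batch.length < n := by omega
  have hpiv : (c.pivot : ℕ) = subspaceQubits s + c.batch.length := colIdx_val hbn.le
  have hP := h.prepared hsn hbn hp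
  set ts := (List.finRange (n + 1)).filter fun i =>
    decide (i ≠ Fin.last n ∧ i ≠ c.pivot ∧ (c.append gs).row j i ≠ subspaceRow n s c.k i) with hts
  have htnd : ts.Nodup := (List.nodup_finRange _).filter _
  have htp : c.pivot ∉ ts := by simp [hts]
  have hrow : ∀ i, ((c.append gs).push j).row i = (ts.map fun i => RevGate.cx c.pivot i).foldl
      (fun x g => g.apply x) ((c.append gs).row i) := fun _ => rfl
  have hrow' : ∀ i, ((c.append gs).push j).row i = if (c.append gs).row i c.pivot = true then
      fun u => if u ∈ ts then !(c.append gs).row i u else (c.append gs).row i u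
      else (c.append gs).row i := fun i => by rw [hrow, foldl_cx _ htnd htp]
  have htv : ∀ g ∈ ts.map fun i => RevGate.cx c.pivot i, g.Valid := by
    intro g hg
    obtain ⟨i, hi, rfl⟩ := List.mem_map.1 hg
    rintro rfl
    exact htp hi
  have hseq : ∀ i ∈ c.batches.flatten ++ c.batch, ((c.append gs).push j).row i = c.row i := by
    intro i hi
    have e : (c.append gs).row i = c.row i := hP.seq i hi
    have ef : c.row i c.pivot = false := h.seq_false hi hpiv.ge (hpiv ▸ hbn)
    rw [hrow', e, if_neg (by rw [ef]; exact Bool.false_ne_true)]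
  have hlo' : ((c.append gs).push j).lo = c.lo := by
    simp [Config.push, Config.append, Config.lo]
  have hcirc : ((c.append gs).push j).circuit = c.circuit ++
      (gs.map fun g => .gate (.rev (g.map Wire.col))) ++
      ((ts.map fun i => RevGate.cx c.pivot i).map fun g => .gate (.rev (g.map Wire.col))) := rfl
  have hbatch : ((c.append gs).push j).batch = c.batch ++ [j] := rfl
  have hbatches : ((c.append gs).push j).batches = c.batches := rfl
  have hts0 : Circuit.toffoli ((ts.map fun i => RevGate.cx c.pivot i).map fun g =>
      (.gate (.rev (g.map Wire.col)) : Instr (Wire n s))) = 0 := by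
    rw [Circuit.toffoli, List.sum_eq_zero_iff]
    simp only [List.map_map, List.mem_map]
    rintro _ ⟨g, hg, rfl⟩
    rfl
  constructor
  · show c.k + 1 ≤ s
    omega
  · rw [hbatch, List.length_append, List.length_singleton]
    omega
  · rw [hbatch, hbatches, List.length_append, List.length_singleton, ← add_assoc, h.length_eq]
    rfl
  · rw [hbatch, hbatches, ← List.append_assoc]
    refine List.Nodup.append h.nodup (List.nodup_singleton j) ?_
    simpa using hP.notMem
  · intro i hi
    rw [hseq i (List.mem_append_left _ hi), hlo']
    exact h.done_row i hi
  · exact h.done_sign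
  · intro t i hi u hu
    rw [hlo']
    rw [hbatch] at hi
    rcases lt_or_ge t c.batch.length with ht | ht
    · rw [List.getElem?_append_left ht] at hi
      rw [hseq i (List.mem_append_right _ (List.mem_of_getElem? hi))]
      exact h.batch_row t i hi u hu
    · rw [List.getElem?_append_right ht] at hi
      obtain ⟨h0, rfl⟩ : t - c.batch.length = 0 ∧ j = i := by
        rcases hz : t - c.batch.length with _ | z
        · simpa [hz] using hi
        · simp [hz] at hi
      obtain rfl : t = c.batch.length := by omega
      have hjp : (c.append gs).row j c.pivot = true := hP.pivot
      rw [hrow', if_pos hjp, hlo]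
      by_cases hup : u = c.pivot
      · subst hup
        simp only [htp, if_false]
        rw [hjp, hpiv]
        simp
      · have hu' : ¬ (u : ℕ) = subspaceQubits s + c.batch.length := fun e =>
          hup (Fin.ext (by rw [e, hpiv]))
        simp only [hu', decide_false, Bool.or_false, hts, List.mem_filter, List.mem_finRange,
          true_and, decide_eq_true_eq, hu, hup, ne_eq, not_false_eq_true]
        cases (c.append gs).row j u <;> cases subspaceRow n s c.k u <;> simp
  · intro i hi
    rw [hbatch, hbatches, ← List.append_assoc] at hi
    have hi' : i ∉ c.batches.flatten ++ c.batch := fun h' => hi (List.mem_append_left _ h')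
    rw [hrow']
    split_ifs with h1
    · exact Or.inr ⟨c.pivot, by omega, by omega, (if_neg htp).trans h1⟩
    · exact hP.live i hi'
  · intro i
    have e := ((h.realizes i).append (realizes_map_col hP.valid (c.row i))).append
      (realizes_map_col htv ((c.append gs).row i))
    rw [hcirc]
    rw [mul_one, mul_one] at e
    exact e
  · rw [hcirc, Circuit.valid_append, Circuit.valid_append]
    exact ⟨⟨h.valid, valid_map_col hP.valid⟩, valid_map_col htv⟩
  · left
    rw [hbatches, hlo']
    rcases h.count with h1 | h1
    · exact h1
    · exact absurd h1.1 hk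
  · rw [hcirc, Circuit.toffoli_append, Circuit.toffoli_append, hts0, hbatch, hbatches,
      List.length_append, List.length_singleton]
    have := h.toffoli_le
    have := hP.toffoli
    omega
  · rw [hcirc]
    simp only [Circuit.inverse_append, Circuit.toffoli_append, h.toffoli_inverse,
      inverse_toffoli_map_gate]
    omega

end Inv

end Config

/-! ### The partial unary iteration of a batch -/

section Controlled

variable {W : Type}

/-- Whether the operation with the given control is applied. -/
def controlOn (ctrl : Option W) (x : W → Bool) : Bool :=
  match ctrl with
  | none => true
  | some c => x c

theorem controlOn_congr {ctrl : Option W} {x y : W → Bool} (h : ∀ c, ctrl = some c → x c = y c) :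
    controlOn ctrl x = controlOn ctrl y := by
  cases ctrl with
  | none => rfl
  | some c => exact h c rfl

variable [Fintype W] [DecidableEq W]

theorem ctrlX_realizes {ctrl : Option W} {t : W} (h : ∀ c, ctrl = some c → c ≠ t)
    (x : W → Bool) :
    Circuit.Realizes [ctrlX ctrl t] x 1
      (fun w => x w ^^ (controlOn ctrl x && decide (w = t))) := by
  cases ctrl with
  | none =>
    change Circuit.Realizes [.gate (.rev (.x t))] _ _ _
    convert Circuit.Realizes.rev (g := .x t) trivial x using 1
    funext w
    by_cases hw : w = t <;> simp [controlOn, RevGate.apply, flipBit, hw]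
  | some c =>
    change Circuit.Realizes [.gate (.rev (.cx c t))] _ _ _
    convert Circuit.Realizes.rev (g := .cx c t) (h c rfl) x using 1
    funext w
    by_cases hw : w = t <;> cases hc : x c <;> simp [controlOn, RevGate.apply, flipBit, hw, hc]

theorem ctrlZ_realizes (ctrl : Option W) {t : W} {x : W → Bool} (hx : x t = true) :
    Circuit.Realizes [ctrlZ ctrl t] x (if controlOn ctrl x = true then -1 else 1) x := by
  cases ctrl with
  | none => simpa [controlOn, hx, ctrlZ] using Circuit.Realizes.z t x
  | some c =>
    convert Circuit.Realizes.cz c t true x using 1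
    · rfl
    · exact if_congr (by simp [controlOn, hx]) rfl rfl

end Controlled

namespace Config

variable {n s : ℕ}

/-- The bits flipped by the operation of the partial unary iteration for an address. -/
def leafMask (c : Config n s) (A : ℕ) (w : Wire n s) : Bool :=
  match c.slot A with
  | none => false
  | some j => decide (w = .col (c.slotCol A)) ^^
      (c.row j (Fin.last n) && decide (w = .col (Fin.last n)))

/-- The sign applied by the partial unary iteration for an address. -/
def leafSign (c : Config n s) (A : ℕ) : ℤˣ :=
  match c.slot A with
  | none => 1
  | some j => c.sign j

/-- The qubits that may control an operation of the partial unary iteration. -/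
def IsControl : Wire n s → Prop
  | .col i => (i : ℕ) < subspaceQubits s
  | .phase => False
  | .anc _ => True

theorem leaf_realizes (c : Config n s) (A : ℕ) (ctrl : Option (Wire n s))
    (h1 : ∀ d, ctrl = some d → d ≠ .col (c.slotCol A))
    (h2 : ∀ d, ctrl = some d → d ≠ .col (Fin.last n)) {x : Wire n s → Bool}
    (hx : x .phase = true) :
    (c.leaf A ctrl).Realizes x (if controlOn ctrl x = true then c.leafSign A else 1)
      (fun w => x w ^^ (controlOn ctrl x && c.leafMask A w)) := by
  cases hA : c.slot A with
  | none =>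
    have e : c.leaf A ctrl = [] := by simp [leaf, hA]
    rw [e]
    simpa [leafSign, leafMask, hA] using Circuit.Realizes.nil x
  | some j =>
    have e : c.leaf A ctrl = [ctrlX ctrl (.col (c.slotCol A))] ++
        (if c.row j (Fin.last n) = true then [ctrlX ctrl (.col (Fin.last n))] else []) ++
        (if c.sign j = -1 then [ctrlZ ctrl .phase] else []) := by simp [leaf, hA]
    set x1 : Wire n s → Bool := fun w => x w ^^ (controlOn ctrl x &&
      decide (w = .col (c.slotCol A))) with hx1
    have hc1 : controlOn ctrl x1 = controlOn ctrl x :=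
      controlOn_congr fun d hd => by simp only [hx1, h1 d hd, decide_false]; simp
    set x2 : Wire n s → Bool := fun w => x1 w ^^ (controlOn ctrl x && (c.row j (Fin.last n) &&
      decide (w = .col (Fin.last n)))) with hx2
    have hc2 : controlOn ctrl x2 = controlOn ctrl x := by
      rw [← hc1]
      exact controlOn_congr fun d hd => by simp only [hx2, h2 d hd, decide_false]; simp
    have r1 := ctrlX_realizes h1 x
    have r2 : Circuit.Realizes (if c.row j (Fin.last n) = true then
        [ctrlX ctrl (.col (Fin.last n))] else []) x1 1 x2 := by
      by_cases hD : c.row j (Fin.last n) = true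
      · rw [if_pos hD]
        convert ctrlX_realizes h2 x1 using 1
        funext w
        simp [hx2, hD, hc1]
      · rw [if_neg hD]
        convert Circuit.Realizes.nil x1 using 1
        funext w
        simp [hx2, hD]
    have r3 : Circuit.Realizes (if c.sign j = -1 then [ctrlZ ctrl .phase] else []) x2
        (if controlOn ctrl x = true then c.sign j else 1) x2 := by
      have hp : x2 .phase = true := by simp [hx2, hx1, hx]
      by_cases hs : c.sign j = -1
      · rw [if_pos hs, hs, ← hc2]
        exact ctrlZ_realizes ctrl hp
      · rw [if_neg hs, (Int.units_eq_one_or (c.sign j)).resolve_right hs, ite_self]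
        exact .nil x2
    have r := (r1.append r2).append r3
    rw [e]
    convert r using 1
    · simp [leafSign, hA]
    · funext w
      simp only [hx2, hx1, leafMask, hA]
      cases controlOn ctrl x <;> simp

theorem leaf_valid (c : Config n s) (A : ℕ) (ctrl : Option (Wire n s))
    (h1 : ∀ d, ctrl = some d → d ≠ .col (c.slotCol A))
    (h2 : ∀ d, ctrl = some d → d ≠ .col (Fin.last n))
    (h3 : ∀ d, ctrl = some d → d ≠ .phase) : (c.leaf A ctrl).Valid := by
  rw [leaf]
  split
  · exact Circuit.valid_nil
  · cases ctrl with
    | none =>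
      simp only [Circuit.valid_append]
      refine ⟨⟨?_, ?_⟩, ?_⟩ <;> (try split_ifs) <;>
        simp [Circuit.Valid, ctrlX, ctrlZ, Instr.Valid, QGate.Valid, RevGate.Valid]
    | some d =>
      have h1 := h1 d rfl
      have h2 := h2 d rfl
      have h3 := h3 d rfl
      simp only [Circuit.valid_append]
      refine ⟨⟨?_, ?_⟩, ?_⟩ <;> (try split_ifs) <;>
        simp_all [Circuit.Valid, ctrlX, ctrlZ, Instr.Valid, QGate.Valid, RevGate.Valid]

theorem leaf_toffoli (c : Config n s) (A : ℕ) (ctrl : Option (Wire n s)) :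
    (c.leaf A ctrl).toffoli = 0 ∧ (c.leaf A ctrl).inverse.toffoli = 0 := by
  rw [leaf]
  split
  · exact ⟨rfl, rfl⟩
  · simp only [Circuit.inverse_append, Circuit.toffoli_append]
    cases ctrl <;> split_ifs <;>
      simp [Circuit.inverse, Circuit.toffoli, ctrlX, ctrlZ, Instr.inverse, Instr.toffoli,
        QGate.toffoli]

theorem flush_row_toWires (c : Config n s) (i : Fin s) :
    Row.toWires s (c.flush.row i) = fun w => Row.toWires s (c.row i) w ^^
      c.leafMask (address s (c.row i)) w := by
  simp only [flush]
  cases hA : c.slot (address s (c.row i)) with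
  | none => funext w; simp [leafMask, hA]
  | some j =>
    have hf : ∀ (t : Fin (n + 1)) (x : Row n) (w : Wire n s),
        Row.toWires s (flipBit t x) w = (Row.toWires s x w ^^ decide (w = .col t)) := by
      intro t x w
      rw [← flipBit_toWires]
      by_cases hw : w = .col t <;> simp [flipBit, hw]
    funext w
    by_cases hD : c.row j (Fin.last n) = true <;> simp [leafMask, hA, hD, hf]

theorem flush_sign (c : Config n s) (i : Fin s) :
    c.flush.sign i = c.sign i * c.leafSign (address s (c.row i)) := by
  simp only [flush, leafSign]
  cases c.slot (address s (c.row i)) <;> simp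

namespace Inv

variable {C : Fin s → Fin n → Bool} {a : Fin s → ℤˣ} {c : Config n s}

theorem slot_none (h : Inv C a c) {A : ℕ} (hA : ¬ (c.lo ≤ A ∧ A < c.k)) : c.slot A = none := by
  have := h.lo_add
  rw [slot]
  split_ifs with h1
  · rw [List.getElem?_eq_none]
    omega
  · rfl

theorem slotCol_val (h : Inv C a c) (hsn : subspaceQubits s < n) {A : ℕ} {j : Fin s}
    (hA : c.slot A = some j) :
    (c.slotCol A : ℕ) = subspaceQubits s + (A - c.lo) ∧ (c.slotCol A : ℕ) < n := by
  rw [slot] at hA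
  split_ifs at hA with h1
  have h2 := (List.getElem?_eq_some_iff.1 hA).1
  have h3 := h.batch_le
  have h4 := batchSize_le hsn
  have e : (c.slotCol A : ℕ) = subspaceQubits s + (A - c.lo) := colIdx_val (by omega)
  exact ⟨e, by omega⟩

theorem slot_lo_add (t : ℕ) : c.slot (c.lo + t) = c.batch[t]? := by
  simp [slot]

theorem leafMask_eq_false (h : Inv C a c) (hsn : subspaceQubits s < n) (A : ℕ) {w : Wire n s}
    (hw : IsControl w ∨ w = .phase) : c.leafMask A w = false := by
  rw [leafMask]
  split
  · rfl
  · rename_i j hA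
    have hv := (h.slotCol_val hsn hA).1
    have h1 : w ≠ .col (c.slotCol A) := by
      rintro rfl
      rcases hw with hw | hw
      · simp only [IsControl] at hw; omega
      · simp at hw
    have h2 : w ≠ .col (Fin.last n) := by
      rintro rfl
      rcases hw with hw | hw
      · simp only [IsControl, Fin.val_last] at hw; omega
      · simp at hw
    simp only [h1, h2, decide_false, Bool.and_false, Bool.xor_false]

theorem leaf_realizes (h : Inv C a c) (hsn : subspaceQubits s < n) (A : ℕ)
    {ctrl : Option (Wire n s)} (hctrl : ∀ d, ctrl = some d → IsControl d) {x : Wire n s → Bool}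
    (hx : x .phase = true) :
    (c.leaf A ctrl).Realizes x (if controlOn ctrl x = true then c.leafSign A else 1)
      (fun w => x w ^^ (controlOn ctrl x && c.leafMask A w)) := by
  cases hA : c.slot A with
  | none =>
    have e : c.leaf A ctrl = [] := by simp [leaf, hA]
    rw [e]
    simpa [leafSign, leafMask, hA] using Circuit.Realizes.nil x
  | some j =>
    have hv := (h.slotCol_val hsn hA).1
    refine c.leaf_realizes A ctrl ?_ ?_ hx
    · rintro d hd rfl
      have := hctrl _ hd
      simp only [IsControl] at this
      omega
    · rintro d hd rfl
      have := hctrl _ hd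
      simp only [IsControl, Fin.val_last] at this
      omega

theorem leaf_valid (h : Inv C a c) (hsn : subspaceQubits s < n) (A : ℕ)
    {ctrl : Option (Wire n s)} (hctrl : ∀ d, ctrl = some d → IsControl d) :
    (c.leaf A ctrl).Valid := by
  cases hA : c.slot A with
  | none =>
    have e : c.leaf A ctrl = [] := by simp [leaf, hA]
    rw [e]
    exact Circuit.valid_nil
  | some j =>
    have hv := (h.slotCol_val hsn hA).1
    refine c.leaf_valid A ctrl ?_ ?_ ?_
    · rintro d hd rfl
      have := hctrl _ hd
      simp only [IsControl] at this
      omega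
    · rintro d hd rfl
      have := hctrl _ hd
      simp only [IsControl, Fin.val_last] at this
      omega
    · rintro d hd rfl
      exact hctrl _ hd

end Inv

theorem addr_isControl (hsn : subspaceQubits s < n) :
    ∀ w ∈ (List.range (subspaceQubits s)).map fun i => (.col (colIdx n i) : Wire n s),
      IsControl w := by
  intro w hw
  obtain ⟨i, hi, rfl⟩ := List.mem_map.1 hw
  have hi := List.mem_range.1 hi
  simp only [IsControl]
  rw [colIdx_val (by omega)]
  exact hi

theorem anc_isControl :
    ∀ w ∈ (List.finRange (subspaceQubits s - 1)).map fun i => (.anc i : Wire n s), IsControl w := by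
  intro w hw
  obtain ⟨i, hi, rfl⟩ := List.mem_map.1 hw
  trivial

theorem nodup_addr_append_anc (hsn : subspaceQubits s < n) :
    (((List.range (subspaceQubits s)).map fun i => (.col (colIdx n i) : Wire n s)) ++
      (List.finRange (subspaceQubits s - 1)).map fun i => (.anc i : Wire n s)).Nodup := by
  refine List.Nodup.append ?_ ((List.nodup_finRange _).map fun _ _ h => by simpa using h) ?_
  · refine List.Nodup.map_on (fun i hi j hj h => ?_) List.nodup_range
    have hi := List.mem_range.1 hi
    have hj := List.mem_range.1 hj
    have := congrArg Fin.val (Wire.col.inj h)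
    rwa [colIdx_val (by omega), colIdx_val (by omega)] at this
  · intro w hw hw'
    obtain ⟨i, -, rfl⟩ := List.mem_map.1 hw
    obtain ⟨j, -, h⟩ := List.mem_map.1 hw'
    simp at h

/-! ### The invariant under a partial unary iteration -/

namespace Inv

variable {C : Fin s → Fin n → Bool} {a : Fin s → ℤˣ} {c : Config n s}

theorem pui_realizes (h : Inv C a c) (hsn : subspaceQubits s < n) (i : Fin s) :
    c.pui.Realizes (Row.toWires s (c.row i)) (c.leafSign (address s (c.row i)))
      (Row.toWires s (c.flush.row i)) := by
  rw [flush_row_toWires, address_eq_readAddress hsn.le]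
  refine restrictedPUI_realizes (ph := Wire.phase) (S := IsControl) (mask := c.leafMask)
    (ε := c.leafSign) ?_ ?_ ?_ ?_ ?_ ?_ (addr_isControl hsn) anc_isControl (by simp)
    (nodup_addr_append_anc hsn) rfl ?_
  · intro A x hx
    simpa [controlOn] using h.leaf_realizes hsn A (ctrl := none) (by simp) hx
  · intro A d x hd hx
    exact h.leaf_realizes hsn A (ctrl := some d) (by simpa using hd) hx
  · exact fun A w hw => h.leafMask_eq_false hsn A (Or.inl hw)
  · exact fun A => h.leafMask_eq_false hsn A (Or.inr rfl)
  · exact fun hf => hf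
  · intro A hA
    simp [leafMask, leafSign, h.slot_none hA]
  · intro w hw
    obtain ⟨i, -, rfl⟩ := List.mem_map.1 hw
    rfl

theorem pui_valid (h : Inv C a c) (hsn : subspaceQubits s < n) : c.pui.Valid :=
  restrictedPUI_valid (S := IsControl) (fun A => h.leaf_valid hsn A (by simp))
    (fun A d hd => h.leaf_valid hsn A (by simpa using hd)) (addr_isControl hsn) anc_isControl
    (by simp) (nodup_addr_append_anc hsn)

/-- The subtraction in `batchBound` is not truncated: if the logarithm `μ` is `0`, then
`subspaceQubits s = n - 1 ≥ 1`; otherwise `μ + 1 ≤ 2 ^ μ` suffices. -/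
theorem batchBound_add (hn : 2 ≤ n) (hsn : subspaceQubits s < n) :
    batchBound n s + Nat.log 2 (n - subspaceQubits s) + 3 =
      2 * batchSize n s + subspaceQubits s := by
  simp only [batchBound, batchSize]
  set μ := Nat.log 2 (n - subspaceQubits s) with hμ
  have : μ + 3 ≤ 2 * 2 ^ μ + subspaceQubits s := by
    rcases Nat.eq_zero_or_pos μ with h0 | h0
    · have : n - subspaceQubits s < 2 := by
        by_contra hlt
        have := Nat.log_pos (b := 2) (by norm_num) (not_lt.1 hlt)
        omega
      rw [h0]; norm_num; omega
    · have h1 : μ + 1 ≤ 2 ^ μ := Nat.lt_two_pow_self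
      omega
  omega

theorem pui_toffoli (h : Inv C a c) (hn : 2 ≤ n) (hsn : subspaceQubits s < n)
    (hb : c.batch ≠ []) :
    c.batch.length - 1 + c.pui.toffoli ≤ batchBound n s := by
  have hB := batchBound_add hn hsn
  have hlo := h.lo_add
  have hbl := h.batch_le
  have hkl := h.k_le
  -- An empty address register is excluded from `restrictedPUI_toffoli_le`. There the iteration is
  -- one uncontrolled leaf, and `s ≤ 1` leaves no room for a second batch element.
  rcases Nat.eq_zero_or_pos (subspaceQubits s) with h0 | h0
  · have hs : s ≤ 1 := by
      have := Nat.le_pow_clog (b := 2) (by norm_num) s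
      rwa [show Nat.clog 2 s = 0 from h0, pow_zero] at this
    have : c.pui.toffoli = 0 := by
      have e : (List.range (subspaceQubits s)).map
          (fun i => (.col (colIdx n i) : Wire n s)) = [] := by simp [h0]
      rw [pui, e]
      exact (c.leaf_toffoli 0 none).1
    omega
  · have hcount : c.batches.length * batchSize n s = c.lo :=
      h.count.resolve_right fun h' => hb h'.2.1
    have hP := restrictedPUI_toffoli_le (lo := c.lo) (hi := c.k) (leaf := c.leaf)
      (μ := Nat.log 2 (n - subspaceQubits s))
      (addr := (List.range (subspaceQubits s)).map fun i => .col (colIdx n i))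
      (anc := (List.finRange (subspaceQubits s - 1)).map .anc)
      (fun A d => (c.leaf_toffoli A d).1) (hcount ▸ Dvd.intro_left _ rfl)
      (by rw [← hlo]; exact Nat.add_le_add_left hbl _)
      (by simpa using h0.ne') (by simp)
    rw [List.length_map, List.length_range] at hP
    change c.pui.toffoli + 2 + _ ≤ _ + batchSize n s at hP
    have := batchSize_pos (n := n) (s := s)
    omega

theorem address_batch (h : Inv C a c) (hsn : subspaceQubits s < n) {t : ℕ} {i : Fin s}
    (hi : c.batch[t]? = some i) : address s (c.row i) = c.lo + t := by
  have ht := (List.getElem?_eq_some_iff.1 hi).1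
  have hlo := h.lo_add
  have hk := h.k_le
  rw [← address_subspaceRow hsn.le (show c.lo + t < s by omega)]
  refine address_congr fun u hu => ?_
  rw [h.batch_row t i hi u (by rintro rfl; simp at hu; omega)]
  simp; omega

/-- The addresses of these rows are below `lo`, outside the interval iterated over. -/
theorem flush_done (h : Inv C a c) (hsn : subspaceQubits s < n) {i : Fin s}
    (hi : i ∈ c.batches.flatten) : c.flush.row i = c.row i ∧ c.flush.sign i = 1 := by
  obtain ⟨A, hA, hr⟩ := h.done_row i hi
  have hlo := h.lo_add
  have hk := h.k_le
  have e : c.slot (address s (c.row i)) = none := by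
    rw [hr, address_subspaceRow hsn.le (by omega)]
    exact h.slot_none (by omega)
  simp only [flush, e]
  exact ⟨trivial, h.done_sign i hi⟩

theorem flush_batch (h : Inv C a c) (hsn : subspaceQubits s < n) {t : ℕ} {i : Fin s}
    (hi : c.batch[t]? = some i) :
    c.flush.row i = subspaceRow n s (c.lo + t) ∧ c.flush.sign i = 1 := by
  have hA := h.address_batch hsn hi
  have hs : c.slot (c.lo + t) = some i := by rw [slot_lo_add, hi]
  obtain ⟨hv, hvn⟩ := h.slotCol_val hsn hs
  rw [Nat.add_sub_cancel_left] at hv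
  constructor
  · funext u
    have e := congrFun (flush_row_toWires c i) (.col u)
    change c.flush.row i u = (c.row i u ^^ _) at e
    rw [e, hA]
    simp only [leafMask, hs, Wire.col.injEq]
    by_cases hu : u = Fin.last n
    · have hne : Fin.last n ≠ c.slotCol (c.lo + t) := by
        intro e; have := congrArg Fin.val e; simp only [Fin.val_last] at this; omega
      subst hu
      rw [subspaceRow_of_le (by simpa using hsn.le)]
      simp only [hne, decide_false, decide_true, Bool.and_true, Bool.false_xor, Bool.xor_self]
    · have hiff : u = c.slotCol (c.lo + t) ↔ (u : ℕ) = subspaceQubits s + t := by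
        rw [Fin.ext_iff, hv]
      rw [h.batch_row t i hi u hu]
      simp only [hiff, hu]
      by_cases hu' : (u : ℕ) = subspaceQubits s + t
      · rw [subspaceRow_of_le (by omega)]
        simp [hu']
      · simp [hu']
  · rw [flush_sign, hA]
    simp only [leafSign, hs]
    exact Int.units_mul_self _

/-- The iteration flips the same bits in all rows with the same address. A row that it made zero in
`r` and the flag would therefore have agreed with the batch element `w` of its address in every
column, contrary to the distinctness of rows. -/
theorem flush_live (h : Inv C a c) (hC : Function.Injective C) (hsn : subspaceQubits s < n)
    {i : Fin s} (hi : i ∉ c.batches.flatten ++ c.batch) : Live s (c.flush.row i) := by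
  cases hA : c.slot (address s (c.row i)) with
  | none =>
    have e : c.flush.row i = c.row i := by simp only [flush, hA]
    rw [e]
    exact h.live i hi
  | some w =>
    obtain ⟨t, ht⟩ : ∃ t, address s (c.row i) = c.lo + t := by
      rw [slot] at hA
      split_ifs at hA with h1
      exact ⟨_, (Nat.add_sub_of_le h1).symm⟩
    have hw : c.batch[t]? = some w := by rw [← slot_lo_add, ← ht, hA]
    by_contra hlive
    simp only [Live, not_or, not_exists, not_and, Bool.not_eq_true] at hlive
    obtain ⟨hl, hu⟩ := hlive
    obtain ⟨hv, hvn⟩ := h.slotCol_val hsn hA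
    rw [ht, Nat.add_sub_cancel_left] at hv
    have e : ∀ u, c.flush.row i u = (c.row i u ^^ (decide (u = c.slotCol (address s (c.row i))) ^^
        (c.row w (Fin.last n) && decide (u = Fin.last n)))) := fun u => by
      have e := congrFun (flush_row_toWires c i) (.col u)
      simpa [leafMask, hA, Row.toWires] using e
    have hrow : c.row i = c.row w := by
      funext u
      rcases lt_or_ge (u : ℕ) (subspaceQubits s) with h1 | h1
      · exact eq_of_address_eq hsn.le (by rw [ht, h.address_batch hsn hw]) u h1
      · by_cases hlast : u = Fin.last n
        · subst hlast
          have hne : Fin.last n ≠ c.slotCol (address s (c.row i)) := by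
            intro e; have := congrArg Fin.val e; simp only [Fin.val_last] at this; omega
          rw [e, decide_eq_false hne] at hl
          simpa using hl
        · have hun : (u : ℕ) < n :=
            lt_of_le_of_ne (Nat.lt_succ_iff.1 u.2) fun e => hlast (Fin.ext e)
          have hz := hu u h1 hun
          have hiff : u = c.slotCol (address s (c.row i)) ↔ (u : ℕ) = subspaceQubits s + t := by
            rw [Fin.ext_iff, ht, hv]
          rw [e, decide_eq_decide.2 hiff, decide_eq_false hlast] at hz
          rw [h.batch_eq hw h1 hun]
          simpa using hz
    exact hi (h.row_injective hC hrow ▸ List.mem_append_right _ (List.mem_of_getElem? hw))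

theorem flush (h : Inv C a c) (hC : Function.Injective C) (hn : 2 ≤ n)
    (hsn : subspaceQubits s < n) (hb : c.batch ≠ [])
    (hbk : c.batch.length = batchSize n s ∨ c.k = s) : Inv C a c.flush := by
  have hlo := h.lo_add
  have hkl := h.k_le
  have hbl := h.batch_le
  have hpos := batchSize_pos (n := n) (s := s)
  have hbpos : 0 < c.batch.length := List.length_pos_iff.2 hb
  have hflat : c.flush.batches.flatten = c.batches.flatten ++ c.batch := by
    simp [Config.flush]
  have hbatch : c.flush.batch = [] := rfl
  have hlo' : c.flush.lo = c.k := rfl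
  have hcirc : c.flush.circuit = c.circuit ++ c.pui := rfl
  have hcount : c.batches.length * batchSize n s = c.lo :=
    h.count.resolve_right fun h' => hb h'.2.1
  have hlen : c.flush.batches.length = c.batches.length + 1 := by simp [Config.flush]
  constructor
  · exact h.k_le
  · exact Nat.zero_le _
  · rw [hflat, hbatch, List.length_append]
    exact h.length_eq
  · rw [hflat, hbatch, List.append_nil]
    exact h.nodup
  · intro i hi
    rw [hflat] at hi
    rw [hlo']
    rcases List.mem_append.1 hi with hi | hi
    · obtain ⟨A, hA, hr⟩ := h.done_row i hi
      exact ⟨A, by omega, (h.flush_done hsn hi).1.trans hr⟩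
    · obtain ⟨t, ht⟩ := List.mem_iff_getElem?.1 hi
      have := (List.getElem?_eq_some_iff.1 ht).1
      exact ⟨c.lo + t, by omega, (h.flush_batch hsn ht).1⟩
  · intro i hi
    rw [hflat] at hi
    rcases List.mem_append.1 hi with hi | hi
    · exact (h.flush_done hsn hi).2
    · obtain ⟨t, ht⟩ := List.mem_iff_getElem?.1 hi
      exact (h.flush_batch hsn ht).2
  · intro t i hi
    simp [hbatch] at hi
  · intro i hi
    rw [hflat, hbatch, List.append_nil] at hi
    exact h.flush_live hC hsn hi
  · intro i
    rw [hcirc, flush_sign, ← mul_assoc]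
    exact (h.realizes i).append (h.pui_realizes hsn i)
  · rw [hcirc, Circuit.valid_append]
    exact ⟨h.valid, h.pui_valid hsn⟩
  · rw [hlen, hlo', add_mul, one_mul, hcount]
    rcases hbk with h1 | h1
    · left; omega
    -- A batch completed at `k = s` may still be full; only a short one leads to the second
    -- alternative of `count`.
    · by_cases h2 : c.batch.length = batchSize n s
      · left; omega
      · right
        exact ⟨h1, hbatch, by omega, by omega⟩
  · rw [hcirc, Circuit.toffoli_append, hlen, add_mul, one_mul]
    have := h.toffoli_le
    have := h.pui_toffoli hn hsn hb
    omega
  · rw [hcirc, Circuit.inverse_append, Circuit.toffoli_append, Circuit.toffoli_append,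
      h.toffoli_inverse, add_comm]
    congr 1
    exact restrictedPUI_toffoli_inverse
      (fun A d => (c.leaf_toffoli A d).2.trans (c.leaf_toffoli A d).1.symm) _ _

end Inv

end Config

/-! ### Correctness of the algorithm -/

theorem card_wire (n s : ℕ) :
    Fintype.card (Wire n s) = n + max (subspaceQubits s) 1 + 1 := by
  let e : Wire n s ≃ Fin (n + 1) ⊕ Unit ⊕ Fin (subspaceQubits s - 1) :=
    { toFun := fun w => match w with
        | .col i => .inl i
        | .phase => .inr (.inl ())
        | .anc i => .inr (.inr i)
      invFun := fun w => match w with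
        | .inl i => .col i
        | .inr (.inl _) => .phase
        | .inr (.inr i) => .anc i
      left_inv := fun w => by cases w <;> rfl
      right_inv := fun w => by rcases w with i | i | i <;> rfl }
  rw [Fintype.card_congr e]
  simp only [Fintype.card_sum, Fintype.card_fin, Fintype.card_unit]
  omega

namespace Config

variable {n s : ℕ} {C : Fin s → Fin n → Bool} {a : Fin s → ℤˣ} {c : Config n s}

/-- Each step raises exactly one of `k` and the number of batches by one, so bounds on these two
bound the number of steps. -/
theorem Run.inv (hn : 2 ≤ n) (hsn : subspaceQubits s < n) (hC : Function.Injective C) {N : ℕ}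
    (h : Run C a N c) : Inv C a c ∧ N = c.k + c.batches.length := by
  induction h with
  | init => exact ⟨inv_init C a, rfl⟩
  | step _ hs ih =>
    obtain ⟨hi, hN⟩ := ih
    cases hs with
    | flush hb hbk =>
      refine ⟨hi.flush hC hn hsn hb hbk, ?_⟩
      simp only [Config.flush, List.length_append, List.length_singleton]
      omega
    | push hb hk gs j hp =>
      refine ⟨hi.push hsn hb hk hp, ?_⟩
      simp only [Config.push, Config.append]
      omega

namespace Inv

theorem exists_step (h : Inv C a c) (hC : Function.Injective C)
    (hf : ¬ c.Finished) : ∃ c', Step c c' := by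
  have hpos := batchSize_pos (n := n) (s := s)
  by_cases hbk : c.batch ≠ [] ∧ (c.batch.length = batchSize n s ∨ c.k = s)
  · exact ⟨_, .flush c hbk.1 hbk.2⟩
  have hk : c.k ≠ s := fun hk => by
    by_cases hb : c.batch = []
    · exact hf ⟨hk, hb⟩
    · exact hbk ⟨hb, Or.inr hk⟩
  have hb : c.batch.length ≠ batchSize n s := fun hb => by
    refine hbk ⟨?_, Or.inl hb⟩
    rw [← List.length_pos_iff]
    omega
  suffices ∃ gs j, c.Prepare gs j by
    obtain ⟨gs, j, hp⟩ := this
    exact ⟨_, .push c hb hk gs j hp⟩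
  by_cases hfree : ∃ j r, c.HasFree j r
  · obtain ⟨j, r, hr⟩ := hfree
    exact ⟨_, j, .swap j r hr⟩
  have hfree' : ∀ i r, ¬ c.HasFree i r := fun i r hr => hfree ⟨i, r, hr⟩
  by_cases hout : ∃ j u, c.Outside j u
  · obtain ⟨j, u, hu⟩ := hout
    -- As no row has a `1` in a free column, `u` is a batch column and belongs to some batch
    -- element.
    have hlt : (u : ℕ) - subspaceQubits s < c.batch.length := by
      by_contra hlt
      exact hfree' j u ⟨by have := hu.2.1; omega, hu.2.2.1, hu.2.2.2⟩
    have hw := List.getElem?_eq_getElem hlt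
    have hne : c.row j ≠ c.row c.batch[(u : ℕ) - subspaceQubits s] := fun e =>
      hu.1 (h.row_injective hC e ▸ List.getElem_mem hlt)
    obtain ⟨v, hv⟩ := Function.ne_iff.1 hne
    exact ⟨_, j, .toffoli hfree' j u v _ hu hw hv⟩
  · obtain ⟨j, hj⟩ : ∃ j, j ∉ c.batches.flatten ++ c.batch := by
      -- The rows already in batches are `k` distinct ones, and `k ≠ s`.
      by_contra hall
      push Not at hall
      have h1 := (List.perm_of_nodup_nodup_toFinset_eq h.nodup (List.nodup_finRange s)
        (by ext i; simpa using hall i)).length_eq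
      rw [List.length_append, h.length_eq, List.length_finRange] at h1
      exact hk h1
    have hj' : j ∉ c.batch := fun hj' => hj (List.mem_append_right _ hj')
    have hD : c.row j (Fin.last n) = true := by
      rcases h.live j hj with hl | ⟨u, hu1, hu2, hu3⟩
      · exact hl
      · exact absurd ⟨j, u, hj', hu1, hu2, hu3⟩ hout
    exact ⟨_, j, .flag hfree' (fun i u hu => hout ⟨i, u, hu⟩) j hj' hD⟩

/-- All batches but the last are full, so one batch fewer covers strictly less than `s` rows. -/
theorem batches_length_le (h : Inv C a c) :
    c.batches.length ≤ ⌈(s : ℝ) / (batchSize n s : ℝ)⌉₊ := by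
  have hpos : (0 : ℝ) < (batchSize n s : ℝ) := by exact_mod_cast batchSize_pos
  have hlo := h.lo_add
  have hk := h.k_le
  rcases Nat.eq_zero_or_pos c.batches.length with h0 | h0
  · omega
  have key : (c.batches.length - 1) * batchSize n s < s := by
    have e : (c.batches.length - 1) * batchSize n s + batchSize n s =
        c.batches.length * batchSize n s := by
      rw [← Nat.succ_mul]
      congr 1
      omega
    have := batchSize_pos (n := n) (s := s)
    rcases h.count with h1 | ⟨-, -, -, h1⟩ <;> omega
  have : c.batches.length - 1 < ⌈(s : ℝ) / (batchSize n s : ℝ)⌉₊ := by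
    rw [Nat.lt_ceil, lt_div_iff₀ hpos]
    exact_mod_cast key
  omega

theorem batches_length_eq (h : Inv C a c) (hf : c.Finished) :
    c.batches.length = ⌈(s : ℝ) / (batchSize n s : ℝ)⌉₊ := by
  refine le_antisymm h.batches_length_le (Nat.ceil_le.2 ?_)
  have hpos : (0 : ℝ) < (batchSize n s : ℝ) := by exact_mod_cast batchSize_pos
  rw [div_le_iff₀ hpos]
  have key : s ≤ c.batches.length * batchSize n s := by
    rcases h.count with h1 | h1
    · have : c.lo = s := by simp [Config.lo, hf.1, hf.2]
      omega
    · exact h1.2.2.1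
  exact_mod_cast key

theorem flatten_perm (h : Inv C a c) (hf : c.Finished) :
    c.batches.flatten.Perm (List.finRange s) := by
  have hnd := h.nodup
  have hl := h.length_eq
  rw [hf.2, List.append_nil] at hnd
  rw [hf.2, hf.1, List.length_nil, add_zero] at hl
  refine (List.perm_ext_iff_of_nodup hnd (List.nodup_finRange s)).2 fun i => ?_
  simp only [List.mem_finRange, iff_true]
  have hu : c.batches.flatten.toFinset = Finset.univ := by
    rw [← Finset.card_eq_iff_eq_univ, List.toFinset_card_of_nodup hnd, hl, Fintype.card_fin]
  simpa using (hu ▸ Finset.mem_univ i : i ∈ c.batches.flatten.toFinset)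

theorem toffoli_le_toffoliBound (h : Inv C a c) (hn : 2 ≤ n) (hsn : subspaceQubits s < n)
    (hf : c.Finished) : (c.circuit.toffoli : ℝ) ≤ toffoliBound n s := by
  have h1 := h.toffoli_le
  rw [hf.2, List.length_nil, Nat.zero_sub, add_zero] at h1
  have hlog : Real.logb 2 ((2 : ℝ) ^ subspaceQubits s / (batchSize n s : ℝ)) =
      (subspaceQubits s : ℝ) - (Nat.log 2 (n - subspaceQubits s) : ℝ) := by
    rw [Real.logb_div (by positivity) (by positivity), Real.logb_pow, Nat.cast_pow, Nat.cast_ofNat,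
      Real.logb_pow, Real.logb_self_eq_one (by norm_num), mul_one, mul_one]
  have hB : ((batchBound n s + Nat.log 2 (n - subspaceQubits s) + 3 : ℕ) : ℝ) =
      ((2 * batchSize n s + subspaceQubits s : ℕ) : ℝ) := by rw [batchBound_add hn hsn]
  rw [Nat.cast_add, Nat.cast_add, Nat.cast_add, Nat.cast_mul] at hB
  have hB' : 2 * (batchSize n s : ℝ) +
      Real.logb 2 ((2 : ℝ) ^ subspaceQubits s / (batchSize n s : ℝ)) - 3 =
      (batchBound n s : ℝ) := by
    rw [hlog]
    push_cast at hB ⊢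
    linarith
  rw [toffoliBound, hB', ← h.batches_length_eq hf]
  exact_mod_cast h1

theorem exists_equiv (h : Inv C a c) (hC : Function.Injective C) (hf : c.Finished) :
    ∃ f : Fin s ≃ Fin s, ∀ i, c.row i = subspaceRow n s (f i) := by
  have hlo : c.lo = s := by simp [Config.lo, hf.1, hf.2]
  have hrow : ∀ i, ∃ A : Fin s, c.row i = subspaceRow n s A := fun i => by
    obtain ⟨A, hA, hr⟩ := h.done_row i ((h.flatten_perm hf).mem_iff.2 (List.mem_finRange i))
    exact ⟨⟨A, hlo ▸ hA⟩, hr⟩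
  choose f hfr using hrow
  have hinj : Function.Injective f := fun i j hij =>
    h.row_injective hC (by rw [hfr, hfr, hij])
  exact ⟨Equiv.ofBijective f (Finite.injective_iff_bijective.1 hinj), hfr⟩

end Inv

end Config

theorem mainTheorem2 (n s : ℕ) (hs : 0 < s) (hn : 2 ≤ n) (hsn : subspaceQubits s < n)
    (C : Fin s → Fin n → Bool) (hC : Function.Injective C) (a : Fin s → ℤˣ) :
    Fintype.card (Wire n s) = n + max (subspaceQubits s) 1 + 1 ∧
    ∀ (N : ℕ) (c : Config n s), Config.Run C a N c →
      N ≤ s + ⌈(s : ℝ) / (batchSize n s : ℝ)⌉₊ ∧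
      (c.Finished ∨ ∃ c', Config.Step c c') ∧
      (c.Finished →
        c.circuit.Valid ∧
        c.batches.length = ⌈(s : ℝ) / (batchSize n s : ℝ)⌉₊ ∧
        c.batches.flatten.Perm (List.finRange s) ∧
        (c.circuit.toffoli : ℝ) ≤ toffoliBound n s ∧
        (c.circuit.inverse.toffoli : ℝ) ≤ toffoliBound n s ∧
        ∃ f : Fin s ≃ Fin s,
          (∀ i, c.row i = subspaceRow n s (f i)) ∧
          c.circuit.Implements a
            (fun i => Row.toWires s (Fin.snoc (α := fun _ => Bool) (C i) true))
            (fun i => Row.toWires s (subspaceRow n s (f i))) ∧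
          c.circuit.inverse.Implements a
            (fun i => Row.toWires s (subspaceRow n s (f i)))
            (fun i => Row.toWires s (Fin.snoc (α := fun _ => Bool) (C i) true))) := by
  refine ⟨card_wire n s, fun N c hrun => ?_⟩
  obtain ⟨h, hN⟩ := hrun.inv hn hsn hC
  refine ⟨?_, ?_, fun hf => ?_⟩
  · rw [hN]
    exact add_le_add h.k_le h.batches_length_le
  · by_cases hf : c.Finished
    · exact Or.inl hf
    · exact Or.inr (h.exists_step hC hf)
  · have ht := h.toffoli_le_toffoliBound hn hsn hf
    obtain ⟨f, hfr⟩ := h.exists_equiv hC hf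
    have hr : ∀ i, c.circuit.Realizes
        (Row.toWires s (Fin.snoc (α := fun _ => Bool) (C i) true)) (a i)
        (Row.toWires s (subspaceRow n s (f i))) := fun i => by
      have e := h.realizes i
      rwa [h.done_sign i ((h.flatten_perm hf).mem_iff.2 (List.mem_finRange i)), mul_one,
        hfr i] at e
    refine ⟨h.valid, h.batches_length_eq hf, h.flatten_perm hf, ht, ?_, f, hfr,
      Circuit.implements_of_mapsKet fun i => (hr i).1,
      Circuit.implements_of_mapsKet fun i => (hr i).2⟩
    rw [h.toffoli_inverse]
    exact ht
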